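/- Let $g_1,\dots,g_m\in\{I,X,Y,Z\}^{\otimes n}$ be Pauli operators (the measured stabilizers) on $n$ data qubits. Let $w_c$ be the maximum number of qubits on which a single $g_i$ acts nontrivially and $w_q$ the maximum number of $g_i$ that act nontrivially on a single qubit (the maximum row and column weights of the parity check matrix), and assume $w_q\ge 1$. A Pauli-square-root Clifford (PSC) is a non-Pauli Clifford unitary whose square lies in the Pauli group $\{\pm1,\pm i\}\times\{I,X,Y,Z\}^{\otimes t}$. Let $\bar U=\bigotimes_{i=1}^{\ell}V_i$ with $\bar U^2=I$, where the $V_i$ are PSCs with pairwise disjoint supports, each on at most $k$ data qubits. Consider a standard protocol of $r=r_S+r_L\ge 1$ rounds, arranged in any order: $r_S$ rounds each measure all of $g_1,\dots,g_m$, and $r_L$ rounds each measure $\bar U$. Every measurement has its own fresh ancilla qubit, prepared in $|+\rangle$. This ancilla is the control of one controlled-Pauli gate for each non-identity tensor factor of $g_i$, respectively of the gates $C(V_1),\dots,C(V_\ell)$; the gates within a round may be executed in any order. All ancillas are measured in the $X$ basis at the end of the circuit. Suppose the circuit has $M$ error locations. An error location is a time before, between or after the gates, together with a set of qubits at which a Pauli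 error may occur; this set is either a single qubit or a set of qubits all involved in one gate of the protocol. Then any error configuration, i.e. any choice of a (possibly trivial) Pauli error at each of the $M$ locations, propagates through the protocol to an end-of-circuit Clifford error consisting of $O\!\left(M r^2 w_q (w_c+\ell)\right)$ one- and two-qubit Clifford gates. More precisely, for every $k$ there is a constant $C_k$, depending only on $k$, such that for all such protocols, locations and configurations the unitary $U_{\mathrm{noisy}}$ of the noisy circuit before the final measurements satisfies $$U_{\mathrm{noisy}} = E\,U_{\mathrm{ideal}},$$ where $U_{\mathrm{ideal}}$ is the unitary of the noiseless circuit and $E$ is a Clifford unitary that is a product of at most $C_k\, M r^2 w_q (w_c+\ell)$ one- and two-qubit Clifford gates. -/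

import Mathlib

namespace PSCProtocol

open Matrix

/-! ### Operators on registers of qubits -/

/-- Linear operators on a register of qubits labelled by `Q`, as matrices in the computational
basis. A basis state is a bit string `Q → Bool`. -/
abbrev Op (Q : Type*) : Type _ := Matrix (Q → Bool) (Q → Bool) ℂ

/-- The four labels of the single-qubit Pauli matrices. -/
inductive Pauli : Type
  | I | X | Y | Z
  deriving DecidableEq

/-- The single-qubit Pauli matrices; `false` is the basis state `|0⟩` and `true` is `|1⟩`. -/
noncomputable def Pauli.mat : Pauli → Matrix Bool Bool ℂ
  | .I => Matrix.of fun x y => if x = y then 1 else 0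
  | .X => Matrix.of fun x y => if x = y then 0 else 1
  | .Y => Matrix.of fun x y => if x = y then 0 else if x then Complex.I else -Complex.I
  | .Z => Matrix.of fun x y => if x = y then (if x then -1 else 1) else 0

/-- A Pauli string: a choice of one of `I, X, Y, Z` for every qubit. -/
abbrev PauliString (Q : Type*) : Type _ := Q → Pauli

section Register

variable {Q : Type*} [Fintype Q] [DecidableEq Q]

/-- The operator `⨂_q P_q` of a Pauli string. -/
noncomputable def pauliOp (P : PauliString Q) : Op Q :=
  Matrix.of fun x y => ∏ q, (P q).mat (x q) (y q)

/-- Membership in the Pauli group `{±1, ±i} × {I, X, Y, Z}^{⊗ Q}`. -/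
def IsPauli (U : Op Q) : Prop :=
  ∃ (a : ℕ) (P : PauliString Q), U = Complex.I ^ a • pauliOp P

/-- Membership in the Clifford group: unitaries that normalize the Pauli group. -/
def IsClifford (U : Op Q) : Prop :=
  U ∈ Matrix.unitaryGroup (Q → Bool) ℂ ∧ ∀ W : Op Q, IsPauli W → IsPauli (U * W * Uᴴ)

/-- A Pauli-square-root Clifford (PSC): a non-Pauli Clifford that squares to a Pauli. -/
def IsPSC (U : Op Q) : Prop :=
  IsClifford U ∧ ¬ IsPauli U ∧ IsPauli (U ^ 2)

/-- The operator `A ⊗ 1` on the register `Q`, where `A` acts on the qubits in the image of `f`. -/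
def embed {R : Type*} [Fintype R] (f : R ↪ Q) (A : Op R) : Op Q :=
  Matrix.of fun x y =>
    if ∀ q, (∀ a, f a ≠ q) → x q = y q then A (fun a => x (f a)) (fun a => y (f a)) else 0

/-- The projector `|b⟩⟨b|` on the qubit `c`, tensored with the identity. -/
def proj (c : Q) (b : Bool) : Op Q :=
  Matrix.diagonal fun x => if x c = b then 1 else 0

/-- The controlled gate `C(U) = |0⟩⟨0| ⊗ 1 + |1⟩⟨1| ⊗ U` with control qubit `c`
(used for operators `U` that act trivially on `c`). -/
def controlled (c : Q) (U : Op Q) : Op Q :=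
  proj c false + proj c true * U

/-- One- and two-qubit Clifford gates on the register `Q`. -/
def IsOneOrTwoQubitClifford (U : Op Q) : Prop :=
  ∃ a : ℕ, (a = 1 ∨ a = 2) ∧ ∃ (f : Fin a ↪ Q) (A : Op (Fin a)), IsClifford A ∧ U = embed f A

end Register

/-! ### Circuits with Pauli noise -/

/-- A gate on the register `Q`: the set of qubits it involves and its operator. -/
structure Gate (Q : Type*) where
  qubits : Finset Q
  op : Op Q

/-- A place where a Pauli error can occur: the number `time` of gates that have been executed
before, and the set of qubits that the error can affect. -/
structure ErrorLocation (Q : Type*) where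
  time : ℕ
  qubits : Finset Q

section Circuit

variable {Q : Type*} [Fintype Q] [DecidableEq Q]

/-- The operator of a noiseless circuit; the first gate of the list is executed first. -/
def idealOp (gs : List (Gate Q)) : Op Q :=
  (gs.map Gate.op).reverse.prod

/-- The admissible error locations of circuit-level noise in the circuit `gs`: an error occurs at
some time between the beginning and the end of the circuit, either on a single qubit
(initialization, idling and measurement errors) or on qubits of one gate (gate errors). -/
def ErrorLocation.Admissible (L : ErrorLocation Q) (gs : List (Gate Q)) : Prop :=
  L.time ≤ gs.length ∧ (L.qubits.card ≤ 1 ∨ ∃ g ∈ gs, L.qubits ⊆ g.qubits)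

/-- An error configuration: a (possibly trivial) Pauli error at each of the error locations. -/
def IsErrorConfiguration {M : ℕ} (loc : Fin M → ErrorLocation Q) (E : Fin M → PauliString Q) :
    Prop :=
  ∀ i q, E i q ≠ Pauli.I → q ∈ (loc i).qubits

/-- The product of all errors that occur at time `t`. -/
noncomputable def errorAt {M : ℕ} (loc : Fin M → ErrorLocation Q) (E : Fin M → PauliString Q)
    (t : ℕ) : Op Q :=
  (((List.finRange M).filter fun i => (loc i).time = t).map fun i => pauliOp (E i)).reverse.prod

/-- The operator of the noisy circuit, starting at time `t` with the gates `gs` still to come. -/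
noncomputable def noisyFrom {M : ℕ} (loc : Fin M → ErrorLocation Q) (E : Fin M → PauliString Q) :
    ℕ → List (Gate Q) → Op Q
  | t, [] => errorAt loc E t
  | t, g :: gs => noisyFrom loc E (t + 1) gs * g.op * errorAt loc E t

/-- The operator of the circuit `gs` with the errors `E` inserted at the locations `loc`. -/
noncomputable def noisyOp {M : ℕ} (loc : Fin M → ErrorLocation Q) (E : Fin M → PauliString Q)
    (gs : List (Gate Q)) : Op Q :=
  noisyFrom loc E 0 gs

end Circuit

/-! ### Standard protocols -/

/-- A standard protocol on `n` data qubits, with `r` rounds. Every round measures either the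
`m` Pauli operators `g 0, …, g (m - 1)` or the transversal PSC `U = ⨂ i, V i`
with `ℓ` tensor factors; the two kinds of rounds are interleaved in any way. Each single
measurement uses its own fresh ancilla qubit, prepared in `|+⟩`, as the control
of controlled-Pauli gates or of the gates `C(V i)`; all ancillas are measured in
the `X` basis at the end. The gates of a round are executed in any order.
(It is not required that the `g i` commute or that `U` preserves a code space.) -/
structure StandardProtocol (n m ℓ r : ℕ) where
  /-- the measured stabilizers -/
  g : Fin m → PauliString (Fin n)
  /-- the qubits on which the tensor factors of the transversal PSC act -/
  T : Fin ℓ → Finset (Fin n)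
  disjoint_T : ∀ i j, i ≠ j → Disjoint (T i) (T j)
  /-- the tensor factors of the transversal PSC -/
  V : (i : Fin ℓ) → Op (T i)
  isPSC_V : ∀ i, IsPSC (V i)
  /-- the transversal PSC squares to the identity -/
  sq_eq_one :
    ((List.finRange ℓ).map fun i =>
      embed (Function.Embedding.subtype fun q => q ∈ T i) (V i)).prod ^ 2 = 1
  /-- whether a round is a PSC round (`true`) or a stabilizer round (`false`) -/
  isPSCRound : Fin r → Bool
  /-- the order of the controlled-Pauli gates, one for every non-identity letter of every
  stabilizer, in a stabilizer round -/
  stabOrder : Fin r → List (Fin m × Fin n)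
  nodup_stabOrder : ∀ s, (stabOrder s).Nodup
  mem_stabOrder : ∀ s p, p ∈ stabOrder s ↔ g p.1 p.2 ≠ Pauli.I
  /-- the order of the gates `C(V i)` in a PSC round -/
  pscOrder : Fin r → List (Fin ℓ)
  nodup_pscOrder : ∀ s, (pscOrder s).Nodup
  mem_pscOrder : ∀ s i, i ∈ pscOrder s

namespace StandardProtocol

variable {n m ℓ r : ℕ} (p : StandardProtocol n m ℓ r)

/-- All qubits: the data qubits, `m` ancillas for every stabilizer round, and one ancilla for
every PSC round. -/
abbrev Qubit : Type :=
  Fin n ⊕ ({s : Fin r // p.isPSCRound s = false} × Fin m) ⊕ {s : Fin r // p.isPSCRound s = true}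

/-- The `j`-th data qubit. -/
def data : Fin n ↪ p.Qubit := Function.Embedding.inl

/-- The ancilla for the `i`-th stabilizer in the stabilizer round `s`. -/
def stabAnc (s : {s : Fin r // p.isPSCRound s = false}) (i : Fin m) : p.Qubit :=
  Sum.inr (Sum.inl (s, i))

/-- The ancilla of the PSC round `s`. -/
def pscAnc (s : {s : Fin r // p.isPSCRound s = true}) : p.Qubit :=
  Sum.inr (Sum.inr s)

/-- The controlled-Pauli gate for the letter of the `i`-th stabilizer at the data qubit `j`. -/
noncomputable def stabGate (s : {s : Fin r // p.isPSCRound s = false}) (i : Fin m) (j : Fin n) :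
    Gate p.Qubit where
  qubits := {p.stabAnc s i, p.data j}
  op := controlled (p.stabAnc s i)
    (pauliOp (Function.update (fun _ => Pauli.I) (p.data j) (p.g i j)))

/-- The gate `C(V i)` of the PSC round `s`. -/
def pscGate (s : {s : Fin r // p.isPSCRound s = true}) (i : Fin ℓ) : Gate p.Qubit where
  qubits := insert (p.pscAnc s) ((p.T i).map p.data)
  op := controlled (p.pscAnc s)
    (embed ((Function.Embedding.subtype fun q => q ∈ p.T i).trans p.data) (p.V i))

/-- The gates of the round `s`. -/
noncomputable def roundGates (s : Fin r) : List (Gate p.Qubit) :=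
  if h : p.isPSCRound s = true then
    (p.pscOrder s).map fun i => p.pscGate ⟨s, h⟩ i
  else
    (p.stabOrder s).map fun c => p.stabGate ⟨s, Bool.eq_false_iff.mpr h⟩ c.1 c.2

/-- All gates of the protocol, round after round. -/
noncomputable def gates : List (Gate p.Qubit) :=
  (List.finRange r).flatMap p.roundGates

/-- The maximum row weight of the parity check matrix: the maximum number of qubits
on which one of the measured stabilizers acts nontrivially. -/
def wc : ℕ :=
  Finset.univ.sup fun i : Fin m => (Finset.univ.filter fun j : Fin n => p.g i j ≠ Pauli.I).card

/-- The maximum column weight of the parity check matrix: the maximum number of measured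
stabilizers that act nontrivially on one qubit. -/
def wq : ℕ :=
  Finset.univ.sup fun j : Fin n => (Finset.univ.filter fun i : Fin m => p.g i j ≠ Pauli.I).card

end StandardProtocol

end PSCProtocol

open PSCProtocol

/-! An error `W` in front of a remaining circuit `G` is moved to the end by solving `G * W = E * G`,
and the proof counts the gates of `E`. Solutions for a product of errors multiply
(`Propagates.mul`), so one single-qubit Pauli error suffices: an admissible location contains at
most `k + 2` qubits, and `exists_noisyFrom` adds up the locations.

What keeps errors from proliferating is that each `V i` squares to a scalar (`exists_sq_eq`): the
squares are Paulis on disjoint supports with product 1. For a Pauli involution `P` on the support of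
`V`, the Pauli `K = P V P Vᴴ` therefore satisfies `K V K = V`, hence commutes or anticommutes with
`V`.

A data error `P` sheds `C(K)` at each gate `C(V)` and at most a `Z` on the ancilla at each
controlled Pauli. A shed `C(K)` passes each later gate at the price of at most one CZ between
ancillas, and these diagonal operators commute with every gate. At most `r` gates `C(V)` and `k * r
* wq` controlled Paulis meet the support of `V`, so the total is `O(r ^ 2 * wq)`
(`BlockCircuit.exists_of_pauli`).

An ancilla error `Z` commutes with the circuit. An ancilla error `X` sheds the target operator of
each of the at most `wc + ℓ` gates that the ancilla controls (`propagates_X`). A shed Pauli is a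
data error again; a shed `V` commutes with `C(V)` and changes `C(R)` into `C(V R Vᴴ)`, which again
costs `O(r ^ 2 * wq)` (`BlockCircuit.exists_of_root`).

The pieces are decomposed into one- and two-qubit gates through Pauli rotations: `gen_rot`,
`gen_controlled` and, for general Cliffords on boundedly many qubits, `IsClifford.gen`. -/

namespace PSCProtocol

open Matrix

set_option linter.unusedSectionVars false

/-! ### Tensor products of single-qubit operators -/

section Tensor

variable {Q : Type*} [Fintype Q] [DecidableEq Q]

/-- The tensor product of single-qubit operators. -/
noncomputable def tens (A : Q → Matrix Bool Bool ℂ) : Op Q :=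
  Matrix.of fun x y => ∏ q, A q (x q) (y q)

theorem tens_mul (A B : Q → Matrix Bool Bool ℂ) :
    tens A * tens B = tens fun q => A q * B q := by
  ext x y
  simp only [tens, Matrix.mul_apply, Matrix.of_apply, ← Finset.prod_mul_distrib]
  rw [Finset.prod_univ_sum, Fintype.piFinset_univ]

theorem tens_smul (c : Q → ℂ) (A : Q → Matrix Bool Bool ℂ) :
    tens (fun q => c q • A q) = (∏ q, c q) • tens A := by
  ext x y
  simp [tens, Finset.prod_mul_distrib]

theorem tens_conjTranspose (A : Q → Matrix Bool Bool ℂ) :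
    (tens A)ᴴ = tens fun q => (A q)ᴴ := by
  ext x y
  simp [tens, Matrix.conjTranspose_apply]

theorem tens_one : tens (fun _ : Q => (1 : Matrix Bool Bool ℂ)) = 1 := by
  ext x y
  by_cases h : x = y
  · subst h; simp [tens]
  · obtain ⟨q, hq⟩ := Function.ne_iff.mp h
    rw [Matrix.one_apply_ne h]
    exact Finset.prod_eq_zero (Finset.mem_univ q) (by simp [hq])

theorem pauliOp_eq_tens (P : PauliString Q) : pauliOp P = tens fun q => (P q).mat := rfl

end Tensor

/-! ### Multiplication and commutation of Pauli letters -/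

section Letters

theorem Pauli.mat_I : Pauli.I.mat = 1 := by
  ext x y; simp [Pauli.mat, Matrix.one_apply]

/-- The product of two Pauli letters, up to phase. -/
def Pauli.mul : Pauli → Pauli → Pauli
  | .I, q => q
  | p, .I => p
  | .X, .X => .I
  | .Y, .Y => .I
  | .Z, .Z => .I
  | .X, .Y => .Z
  | .Y, .X => .Z
  | .Y, .Z => .X
  | .Z, .Y => .X
  | .Z, .X => .Y
  | .X, .Z => .Y

/-- The exponent of `i` in the product of two Pauli letters. -/
def Pauli.phase : Pauli → Pauli → ℕ
  | .X, .Y => 1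
  | .Y, .Z => 1
  | .Z, .X => 1
  | .Y, .X => 3
  | .Z, .Y => 3
  | .X, .Z => 3
  | _, _ => 0

/-- The sign with which two Pauli letters commute. -/
def Pauli.sign (p q : Pauli) : ℂ := if p = .I ∨ q = .I ∨ p = q then 1 else -1

theorem Pauli.mat_mul (p q : Pauli) :
    p.mat * q.mat = Complex.I ^ Pauli.phase p q • (Pauli.mul p q).mat := by
  cases p <;> cases q <;> ext x y <;> cases x <;> cases y <;>
    simp [Pauli.mat, Pauli.mul, Pauli.phase, Matrix.mul_apply, pow_succ]

theorem Pauli.mat_comm (p q : Pauli) :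
    p.mat * q.mat = Pauli.sign p q • (q.mat * p.mat) := by
  cases p <;> cases q <;> ext x y <;> cases x <;> cases y <;>
    simp [Pauli.mat, Pauli.sign, Matrix.mul_apply]

theorem Pauli.mat_sq (p : Pauli) : p.mat * p.mat = 1 := by
  cases p <;> ext x y <;> cases x <;> cases y <;> simp [Pauli.mat, Matrix.mul_apply]

theorem Pauli.mat_conjTranspose (p : Pauli) : p.matᴴ = p.mat := by
  cases p <;> ext x y <;> cases x <;> cases y <;> simp [Pauli.mat, Matrix.conjTranspose_apply]

theorem Pauli.sign_eq (p q : Pauli) : Pauli.sign p q = 1 ∨ Pauli.sign p q = -1 := by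
  unfold Pauli.sign; split_ifs <;> simp

theorem Pauli.eq_I_of_sign {p : Pauli} (hX : Pauli.sign p .X = 1) (hZ : Pauli.sign p .Z = 1) :
    p = .I := by
  have h : (-1 : ℂ) ≠ 1 := by norm_num
  cases p
  · rfl
  · exact absurd hZ (by simpa [Pauli.sign] using h)
  · exact absurd hX (by simpa [Pauli.sign] using h)
  · exact absurd hX (by simpa [Pauli.sign] using h)

theorem Pauli.exists_sign_eq_neg_one {p : Pauli} (hp : p ≠ .I) : ∃ q, Pauli.sign p q = -1 := by
  cases p
  · exact absurd rfl hp
  · exact ⟨.Z, by simp [Pauli.sign]⟩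
  · exact ⟨.Z, by simp [Pauli.sign]⟩
  · exact ⟨.X, by simp [Pauli.sign]⟩

end Letters

/-! ### The Pauli group, supports and the commutant -/

section PauliOps

variable {Q : Type*} [Fintype Q] [DecidableEq Q]

theorem pauliOp_mul (P P' : PauliString Q) :
    pauliOp P * pauliOp P' =
      Complex.I ^ (∑ q, Pauli.phase (P q) (P' q)) • pauliOp fun q => Pauli.mul (P q) (P' q) := by
  simp only [pauliOp_eq_tens, tens_mul, Pauli.mat_mul, tens_smul, Finset.prod_pow_eq_pow_sum]

theorem pauliOp_comm (P P' : PauliString Q) :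
    pauliOp P * pauliOp P' = (∏ q, Pauli.sign (P q) (P' q)) • (pauliOp P' * pauliOp P) := by
  simp only [pauliOp_eq_tens, tens_mul, ← tens_smul]
  congr 1; funext q; exact Pauli.mat_comm _ _

theorem pauliOp_sq (P : PauliString Q) : pauliOp P * pauliOp P = 1 := by
  simp only [pauliOp_eq_tens, tens_mul, Pauli.mat_sq, tens_one]

theorem pauliOp_conjTranspose (P : PauliString Q) : (pauliOp P)ᴴ = pauliOp P := by
  simp only [pauliOp_eq_tens, tens_conjTranspose, Pauli.mat_conjTranspose]

theorem pauliOp_one : pauliOp (fun _ : Q => Pauli.I) = 1 := by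
  simp only [pauliOp_eq_tens, Pauli.mat_I, tens_one]

/-- The Pauli string with a single letter. -/
def single (q : Q) (p : Pauli) : PauliString Q := Function.update (fun _ => Pauli.I) q p

@[simp] theorem single_self (q : Q) (p : Pauli) : single q p q = p := by simp [single]

theorem single_of_ne {q q' : Q} (h : q' ≠ q) (p : Pauli) : single q p q' = .I := by
  simp [single, h]

/-- Pauli group elements supported on a set of qubits. -/
def IsPauliOn (S : Finset Q) (W : Op Q) : Prop :=
  ∃ (a : ℕ) (P : PauliString Q), (∀ q ∉ S, P q = .I) ∧ W = Complex.I ^ a • pauliOp P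

theorem IsPauliOn.isPauli {S : Finset Q} {W : Op Q} (h : IsPauliOn S W) : IsPauli W := by
  obtain ⟨a, P, -, rfl⟩ := h; exact ⟨a, P, rfl⟩

theorem IsPauli.isPauliOn_univ {W : Op Q} (h : IsPauli W) : IsPauliOn Finset.univ W := by
  obtain ⟨a, P, rfl⟩ := h; exact ⟨a, P, by simp, rfl⟩

theorem IsPauliOn.mono {S S' : Finset Q} (h : S ⊆ S') {W : Op Q} (hW : IsPauliOn S W) :
    IsPauliOn S' W := by
  obtain ⟨a, P, hP, rfl⟩ := hW; exact ⟨a, P, fun q hq => hP q fun h' => hq (h h'), rfl⟩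

theorem IsPauliOn.mul {S : Finset Q} {W W' : Op Q} (h : IsPauliOn S W) (h' : IsPauliOn S W') :
    IsPauliOn S (W * W') := by
  obtain ⟨a, P, hP, rfl⟩ := h
  obtain ⟨b, P', hP', rfl⟩ := h'
  refine ⟨a + b + ∑ q, Pauli.phase (P q) (P' q), fun q => Pauli.mul (P q) (P' q),
    fun q hq => by simp [hP q hq, hP' q hq, Pauli.mul], ?_⟩
  rw [smul_mul_smul_comm, pauliOp_mul, smul_smul, pow_add, pow_add]

theorem IsPauliOn.smul {S : Finset Q} {W : Op Q} (h : IsPauliOn S W) (a : ℕ) :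
    IsPauliOn S (Complex.I ^ a • W) := by
  obtain ⟨b, P, hP, rfl⟩ := h
  exact ⟨a + b, P, hP, by rw [smul_smul, pow_add]⟩

theorem IsPauliOn.smul_I {S : Finset Q} {W : Op Q} (h : IsPauliOn S W) :
    IsPauliOn S (Complex.I • W) := by simpa using h.smul 1

theorem IsPauliOn.neg {S : Finset Q} {W : Op Q} (h : IsPauliOn S W) : IsPauliOn S (-W) := by
  simpa using h.smul 2

theorem isPauliOn_one (S : Finset Q) : IsPauliOn S (1 : Op Q) :=
  ⟨0, fun _ => .I, fun _ _ => rfl, by simp [pauliOp_one]⟩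

theorem isPauliOn_pauliOp {S : Finset Q} {P : PauliString Q} (hP : ∀ q ∉ S, P q = .I) :
    IsPauliOn S (pauliOp P) := ⟨0, P, hP, by simp⟩

theorem isPauliOn_single {S : Finset Q} {q : Q} (hq : q ∈ S) (p : Pauli) :
    IsPauliOn S (pauliOp (single q p)) :=
  isPauliOn_pauliOp fun q' hq' => single_of_ne (by rintro rfl; exact hq' hq) p

theorem IsPauli.mul {W W' : Op Q} (h : IsPauli W) (h' : IsPauli W') : IsPauli (W * W') :=
  (h.isPauliOn_univ.mul h'.isPauliOn_univ).isPauli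

theorem IsPauli.comm {A B : Op Q} (hA : IsPauli A) (hB : IsPauli B) :
    A * B = B * A ∨ A * B = -(B * A) := by
  obtain ⟨a, P, rfl⟩ := hA
  obtain ⟨b, P', rfl⟩ := hB
  have h : (∏ q, Pauli.sign (P q) (P' q)) = 1 ∨ (∏ q, Pauli.sign (P q) (P' q)) = -1 := by
    refine Finset.prod_induction _ (fun x : ℂ => x = 1 ∨ x = -1) ?_ (by simp)
      fun q _ => Pauli.sign_eq _ _
    rintro _ _ (rfl | rfl) (rfl | rfl) <;> simp
  rw [smul_mul_smul_comm, smul_mul_smul_comm, pauliOp_comm P P', mul_comm]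
  rcases h with h | h <;> rw [h] <;> simp

theorem IsPauli.sq {A : Op Q} (hA : IsPauli A) : A * A = 1 ∨ A * A = -1 := by
  obtain ⟨a, P, rfl⟩ := hA
  rw [smul_mul_smul_comm, pauliOp_sq, ← pow_add, ← two_mul, pow_mul, Complex.I_sq]
  rcases neg_one_pow_eq_or ℂ a with h | h <;> rw [h] <;> simp

theorem I_pow_mul_conj (a : ℕ) : Complex.I ^ a * star (Complex.I ^ a) = 1 := by
  rw [star_pow, ← mul_pow]; simp

theorem IsPauli.mul_conjTranspose {A : Op Q} (hA : IsPauli A) : A * Aᴴ = 1 := by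
  obtain ⟨a, P, rfl⟩ := hA
  rw [conjTranspose_smul, smul_mul_smul_comm, pauliOp_conjTranspose, pauliOp_sq, I_pow_mul_conj,
    one_smul]

theorem pauliOp_ne_zero (P : PauliString Q) : pauliOp P ≠ 0 := by
  intro h
  have := pauliOp_sq P
  rw [h, zero_mul] at this
  exact zero_ne_one this

theorem prod_sign_single (P : PauliString Q) (q : Q) (p : Pauli) :
    (∏ q', Pauli.sign (P q') (single q p q')) = Pauli.sign (P q) p := by
  rw [Finset.prod_eq_single q]
  · simp
  · intro q' _ h; simp [single_of_ne h, Pauli.sign]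
  · simp

theorem sign_eq_one_of_commute {P : PauliString Q} {q : Q} {p : Pauli}
    (h : Commute (pauliOp P) (pauliOp (single q p))) : Pauli.sign (P q) p = 1 := by
  have h1 := pauliOp_comm P (single q p)
  rw [prod_sign_single, h.eq] at h1
  rcases Pauli.sign_eq (P q) p with h2 | h2
  · exact h2
  · exfalso
    rw [h2, neg_one_smul] at h1
    have h0 : pauliOp (single q p) * pauliOp P = 0 := by
      ext x y
      exact self_eq_neg.mp (congrFun (congrFun h1 x) y)
    have h3 : pauliOp (single q p) * (pauliOp (single q p) * pauliOp P) = 0 := by rw [h0, mul_zero]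
    rw [← mul_assoc, pauliOp_sq, one_mul] at h3
    exact pauliOp_ne_zero _ h3

theorem eq_I_of_commute {P : PauliString Q} {q : Q}
    (h : ∀ p, Commute (pauliOp P) (pauliOp (single q p))) : P q = .I :=
  Pauli.eq_I_of_sign (sign_eq_one_of_commute (h .X)) (sign_eq_one_of_commute (h .Z))

/-- A Pauli operator that commutes with all single-qubit Pauli operators off `S` is supported
on `S`. -/
theorem IsPauli.isPauliOn {S : Finset Q} {W : Op Q} (hW : IsPauli W)
    (h : ∀ q ∉ S, ∀ p, Commute W (pauliOp (single q p))) : IsPauliOn S W := by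
  obtain ⟨a, P, rfl⟩ := hW
  refine ⟨a, P, fun q hq => eq_I_of_commute fun p => ?_, rfl⟩
  have h1 := h q hq p
  have h2 := (Commute.smul_left h1 (Complex.I ^ a)⁻¹)
  rwa [smul_smul, inv_mul_cancel₀ (pow_ne_zero _ Complex.I_ne_zero), one_smul] at h2

theorem pauliOp_mul_of_disjoint {P P' P'' : PauliString Q}
    (h : ∀ q, (P q = .I ∧ P'' q = P' q) ∨ (P' q = .I ∧ P'' q = P q)) :
    pauliOp P * pauliOp P' = pauliOp P'' := by
  simp only [pauliOp_eq_tens, tens_mul]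
  congr 1; funext q
  rcases h q with ⟨h, h'⟩ | ⟨h, h'⟩ <;> rw [h, h', Pauli.mat_I] <;> simp

theorem pauliOp_commute_of_disjoint {P P' : PauliString Q} (h : ∀ q, P q = .I ∨ P' q = .I) :
    Commute (pauliOp P) (pauliOp P') := by
  simp only [pauliOp_eq_tens, Commute, SemiconjBy, tens_mul]
  congr 1; funext q
  rcases h q with h | h <;> rw [h, Pauli.mat_I] <;> simp

theorem pauliOp_single_Z (q : Q) :
    pauliOp (single q .Z) = Matrix.diagonal fun x => if x q then (-1 : ℂ) else 1 := by
  ext x y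
  by_cases hxy : x = y
  · subst hxy
    rw [Matrix.diagonal_apply_eq]
    show ∏ q', _ = _
    rw [Finset.prod_eq_single q]
    · simp [Pauli.mat]
    · intro q' _ h; simp [single_of_ne h, Pauli.mat]
    · simp
  · rw [Matrix.diagonal_apply_ne _ hxy]
    obtain ⟨q', hq'⟩ := Function.ne_iff.mp hxy
    refine Finset.prod_eq_zero (Finset.mem_univ q') ?_
    by_cases h : q' = q
    · subst h; simp [Pauli.mat, hq']
    · simp [single_of_ne h, Pauli.mat, hq']

/-- Operators that commute with all Pauli operators are scalars. -/
theorem eq_smul_one_of_commute {U : Op Q} (h : ∀ P, Commute U (pauliOp P)) :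
    ∃ u : ℂ, U = u • 1 := by
  -- Commuting with a `Z` on a qubit where `x` and `y` differ gives `U x y` the opposite sign.
  have hdiag : ∀ x y, x ≠ y → U x y = 0 := by
    intro x y hxy
    obtain ⟨q, hq⟩ := Function.ne_iff.mp hxy
    have h1 := congrFun (congrFun (h (single q .Z)).eq x) y
    rw [pauliOp_single_Z, Matrix.mul_diagonal, Matrix.diagonal_mul] at h1
    cases hx : x q <;> cases hy : y q <;> rw [hx, hy] at h1 hq
    · exact absurd rfl hq
    · simp only [if_true, Bool.false_eq_true, if_false, mul_neg, mul_one, one_mul] at h1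
      exact neg_eq_self.mp h1
    · simp only [if_true, Bool.false_eq_true, if_false, neg_mul, mul_one, one_mul] at h1
      exact self_eq_neg.mp h1
    · exact absurd rfl hq
  -- The string with an `X` wherever `x` and `y` differ maps one basis state to the other, so it
  -- transports the diagonal entry.
  have hconst : ∀ x y, U x x = U y y := by
    intro x y
    set P : PauliString Q := fun q => if x q = y q then .I else .X
    have hP : ∀ z w, (∀ q, P q = .I ∨ z q ≠ w q) → (∀ q, P q = .X ∨ z q = w q) →
        pauliOp P z w = 1 := by
      intro z w h1 h2
      refine Finset.prod_eq_one fun q _ => ?_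
      have h1 := h1 q; have h2 := h2 q
      rcases h1 with h1 | h1
      · rcases h2 with h2 | h2
        · rw [h1] at h2; cases h2
        · rw [h1]; exact if_pos h2
      · rcases h2 with h2 | h2
        · rw [h2]; exact if_neg h1
        · exact absurd h2 h1
    have hxy : pauliOp P x y = 1 := hP _ _ (fun q => by by_cases h : x q = y q <;> simp [P, h])
      (fun q => by by_cases h : x q = y q <;> simp [P, h])
    have h1 := congrFun (congrFun (h P).eq x) y
    rw [Matrix.mul_apply, Matrix.mul_apply, Finset.sum_eq_single x, Finset.sum_eq_single y, hxy,
      mul_one, one_mul] at h1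
    · exact h1
    · intro z _ hz; rw [hdiag z y hz, mul_zero]
    · simp
    · intro z _ hz; rw [hdiag x z hz.symm, zero_mul]
    · simp
  refine ⟨U (fun _ => false) (fun _ => false), ?_⟩
  ext x y
  by_cases hxy : x = y
  · subst hxy; simp [hconst x (fun _ => false)]
  · simp [hxy, hdiag x y hxy]

end PauliOps

/-! ### Operators on a subset of the qubits -/

section Embed

variable {Q R R' : Type*} [Fintype Q] [DecidableEq Q] [Fintype R] [Fintype R']
  [DecidableEq R] [DecidableEq R']

theorem embed_mul (f : R ↪ Q) (A B : Op R) : embed f (A * B) = embed f A * embed f B := by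
  ext x y
  rw [Matrix.mul_apply]
  simp only [embed, Matrix.of_apply]
  -- In the matrix product only intermediate bit strings agreeing with `x` off the range of `f`
  -- contribute; these are parametrized by their restriction `w`.
  have key := Fintype.sum_of_injective (fun w : R → Bool => Function.extend f w x)
    (fun w w' h => by
      funext a
      have := congrFun h (f a)
      simpa [f.injective.extend_apply] using this)
    (fun w => if ∀ q, (∀ a, f a ≠ q) → x q = y q then
      A (fun a => x (f a)) w * B w (fun a => y (f a)) else 0)
    (fun z => (if ∀ q, (∀ a, f a ≠ q) → x q = z q then
      A (fun a => x (f a)) (fun a => z (f a)) else 0) *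
      (if ∀ q, (∀ a, f a ≠ q) → z q = y q then B (fun a => z (f a)) (fun a => y (f a)) else 0))
    (fun z hz => by
      rw [if_neg, zero_mul]
      intro h
      refine hz ⟨fun a => z (f a), funext fun q => ?_⟩
      by_cases hq : ∃ a, f a = q
      · obtain ⟨a, rfl⟩ := hq
        exact f.injective.extend_apply _ _ _
      · refine (Function.extend_apply' _ _ _ hq).trans ?_
        exact h q (by simpa using hq))
    (fun w => by
      have h1 : ∀ q, (∀ a, f a ≠ q) → Function.extend f w x q = x q := fun q hq =>
        Function.extend_apply' _ _ _ (by simpa using hq)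
      have h2 : ∀ a, Function.extend f w x (f a) = w a := fun a =>
        f.injective.extend_apply _ _ _
      have h3 : (∀ q, (∀ a, f a ≠ q) → x q = Function.extend f w x q) :=
        fun q hq => (h1 q hq).symm
      have h4 : (∀ q, (∀ a, f a ≠ q) → Function.extend f w x q = y q) ↔
          ∀ q, (∀ a, f a ≠ q) → x q = y q :=
        forall_congr' fun q => forall_congr' fun hq => by rw [h1 q hq]
      simp only [h2, if_pos h3, h4]
      split_ifs <;> simp)
  rw [← key, Matrix.mul_apply]
  split_ifs <;> simp

theorem embed_add (f : R ↪ Q) (A B : Op R) : embed f (A + B) = embed f A + embed f B := by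
  ext x y; simp only [embed, Matrix.of_apply, Matrix.add_apply]; split_ifs <;> simp

theorem embed_smul (f : R ↪ Q) (c : ℂ) (A : Op R) : embed f (c • A) = c • embed f A := by
  ext x y; simp only [embed, Matrix.of_apply, Matrix.smul_apply]; split_ifs <;> simp

theorem embed_conjTranspose (f : R ↪ Q) (A : Op R) : embed f Aᴴ = (embed f A)ᴴ := by
  ext x y
  simp only [embed, Matrix.of_apply, Matrix.conjTranspose_apply, eq_comm (a := x _)]
  split_ifs <;> simp

theorem embed_injective (f : R ↪ Q) : Function.Injective (embed f) := by
  intro A B h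
  ext x y
  have := congrFun (congrFun h (Function.extend f x fun _ => false))
    (Function.extend f y fun _ => false)
  have h1 : ∀ w : R → Bool, (fun a => Function.extend f w (fun _ => false) (f a)) = w := fun w =>
    funext fun a => f.injective.extend_apply _ _ _
  simp only [embed, Matrix.of_apply, h1] at this
  rwa [if_pos, if_pos] at this <;>
  · intro q hq
    rw [Function.extend_apply' _ _ _ (by simpa using hq),
      Function.extend_apply' _ _ _ (by simpa using hq)]

theorem tens_eq_embed (f : R ↪ Q) (A : Q → Matrix Bool Bool ℂ) (h : ∀ q, (∀ a, f a ≠ q) → A q = 1) :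
    tens A = embed f (tens fun a => A (f a)) := by
  ext x y
  simp only [tens, embed, Matrix.of_apply]
  split_ifs with hxy
  · refine (Fintype.prod_of_injective f f.injective _ _ (fun q hq => ?_) fun a => rfl).symm
    have hq' : ∀ a, f a ≠ q := by simpa using hq
    rw [h q hq', hxy q hq', Matrix.one_apply_eq]
  · push Not at hxy
    obtain ⟨q, hq, hne⟩ := hxy
    exact Finset.prod_eq_zero (Finset.mem_univ q) (by rw [h q hq, Matrix.one_apply_ne hne])

theorem embed_one (f : R ↪ Q) : embed f (1 : Op R) = 1 := by
  rw [← tens_one, ← tens_one]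
  exact (tens_eq_embed f (fun _ => 1) fun _ _ => rfl).symm

theorem pauliOp_eq_embed (f : R ↪ Q) (P : PauliString Q) (h : ∀ q, (∀ a, f a ≠ q) → P q = .I) :
    pauliOp P = embed f (pauliOp fun a => P (f a)) :=
  tens_eq_embed f _ fun q hq => by rw [h q hq, Pauli.mat_I]

theorem embed_mul_embed_apply (f : R ↪ Q) (g : R' ↪ Q) (hfg : ∀ a b, f a ≠ g b) (A : Op R)
    (B : Op R') (x y : Q → Bool) :
    (embed f A * embed g B) x y =
      if ∀ q, (∀ a, f a ≠ q) → (∀ b, g b ≠ q) → x q = y q then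
        A (fun a => x (f a)) (fun a => y (f a)) * B (fun b => x (g b)) (fun b => y (g b))
      else 0 := by
  set z : Q → Bool := Function.extend f (fun a => y (f a)) x
  have hz1 : ∀ a, z (f a) = y (f a) := fun a => f.injective.extend_apply _ _ _
  have hz2 : ∀ q, (∀ a, f a ≠ q) → z q = x q := fun q hq =>
    Function.extend_apply' _ _ _ (by simpa using hq)
  rw [Matrix.mul_apply, Finset.sum_eq_single z]
  · simp only [embed, Matrix.of_apply, hz1]
    rw [if_pos fun q hq => (hz2 q hq).symm]
    have h3 : (∀ q, (∀ b, g b ≠ q) → z q = y q) ↔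
        ∀ q, (∀ a, f a ≠ q) → (∀ b, g b ≠ q) → x q = y q := by
      refine forall_congr' fun q => ?_
      by_cases hq : ∃ a, f a = q
      · obtain ⟨a, rfl⟩ := hq
        simp [hz1]
      · have hq' : ∀ a, f a ≠ q := by simpa using hq
        rw [hz2 q hq']; simp [hq']
    simp only [h3, fun b => hz2 (g b) fun a => hfg a b]
    split_ifs <;> simp
  · intro w _ hw
    simp only [embed, Matrix.of_apply]
    by_cases h1 : ∀ q, (∀ a, f a ≠ q) → x q = w q
    · by_cases h2 : ∀ q, (∀ b, g b ≠ q) → w q = y q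
      · refine absurd (funext fun q => ?_) hw
        by_cases hq : ∃ a, f a = q
        · obtain ⟨a, rfl⟩ := hq
          rw [hz1, h2 _ fun b => (hfg a b).symm]
        · have hq' : ∀ a, f a ≠ q := by simpa using hq
          rw [hz2 q hq', h1 q hq']
      · rw [if_neg h2, mul_zero]
    · rw [if_neg h1, zero_mul]
  · simp

/-- Operators on disjoint sets of qubits commute. -/
theorem embed_commute (f : R ↪ Q) (g : R' ↪ Q) (hfg : ∀ a b, f a ≠ g b) (A : Op R) (B : Op R') :
    Commute (embed f A) (embed g B) := by
  show _ * _ = _ * _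
  ext x y
  rw [embed_mul_embed_apply f g hfg, embed_mul_embed_apply g f fun b a => (hfg a b).symm, mul_comm]
  refine if_congr ⟨fun h q h1 h2 => h q h2 h1, fun h q h1 h2 => h q h2 h1⟩ rfl rfl

open Classical in
theorem tens_commute_embed (f : R ↪ Q) (A : Q → Matrix Bool Bool ℂ) (h : ∀ a, A (f a) = 1)
    (B : Op R) : Commute (tens A) (embed f B) := by
  rw [tens_eq_embed (Function.Embedding.subtype fun q => ∀ a, f a ≠ q) A]
  · exact embed_commute _ _ (fun q a => (q.2 a).symm) _ _
  · intro q hq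
    by_cases h' : ∃ a, f a = q
    · obtain ⟨a, rfl⟩ := h'; exact h a
    · exact absurd rfl (hq ⟨q, by simpa using h'⟩)

theorem pauliOp_commute_embed (f : R ↪ Q) (P : PauliString Q) (h : ∀ a, P (f a) = .I)
    (B : Op R) : Commute (pauliOp P) (embed f B) :=
  tens_commute_embed f _ (fun a => by rw [h a, Pauli.mat_I]) B

theorem isPauli_embed (f : R ↪ Q) {W : Op R} (hW : IsPauli W) :
    IsPauliOn (Finset.univ.map f) (embed f W) := by
  obtain ⟨a, P, rfl⟩ := hW
  refine ⟨a, Function.extend f P fun _ => .I, fun q hq => ?_, ?_⟩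
  · exact Function.extend_apply' _ _ _ (by simpa using hq)
  · rw [embed_smul, pauliOp_eq_embed f (Function.extend f P fun _ => .I)]
    · congr 3; funext a; exact (f.injective.extend_apply _ _ _).symm
    · intro q hq; exact Function.extend_apply' _ _ _ (by simpa using hq)

theorem embed_mem_unitaryGroup (f : R ↪ Q) {A : Op R}
    (hA : A ∈ Matrix.unitaryGroup (R → Bool) ℂ) :
    embed f A ∈ Matrix.unitaryGroup (Q → Bool) ℂ := by
  rw [Matrix.mem_unitaryGroup_iff] at hA ⊢
  rw [Matrix.star_eq_conjTranspose] at hA ⊢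
  rw [← embed_conjTranspose, ← embed_mul, hA, embed_one]

open Classical in
theorem IsClifford.embed (f : R ↪ Q) {A : Op R} (hA : IsClifford A) :
    IsClifford (PSCProtocol.embed f A) := by
  refine ⟨embed_mem_unitaryGroup f hA.1, ?_⟩
  rintro _ ⟨a, P, rfl⟩
  -- The string factors into its parts on and off the range of `f`: the embedded operator conjugates
  -- the first and commutes with the second.
  set Pin : PauliString Q := fun q => if ∃ a, f a = q then P q else .I with hPin
  set Pout : PauliString Q := fun q => if ∃ a, f a = q then .I else P q with hPout
  have h1 : pauliOp Pin * pauliOp Pout = pauliOp P :=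
    pauliOp_mul_of_disjoint fun q => by by_cases h : ∃ a, f a = q <;> simp [hPin, hPout, h]
  have h2 := pauliOp_eq_embed f Pin fun q hq => by simp [hPin, hq]
  have h3 : Commute (pauliOp Pout) (PSCProtocol.embed f Aᴴ) :=
    pauliOp_commute_embed f Pout (fun a => by simp [hPout]) _
  have h4 : PSCProtocol.embed f A * (Complex.I ^ a • pauliOp P) * (PSCProtocol.embed f A)ᴴ =
      Complex.I ^ a • (PSCProtocol.embed f (A * pauliOp (fun a => Pin (f a)) * Aᴴ) *
        pauliOp Pout) := by
    rw [embed_mul, embed_mul, ← h2, mul_assoc (_ * _) _ (pauliOp Pout), ← h3.eq, ← h1,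
      embed_conjTranspose]
    simp only [mul_assoc, Matrix.mul_smul, Matrix.smul_mul]
  rw [h4]
  have h5 := hA.2 (pauliOp fun a => Pin (f a)) ⟨0, fun a => Pin (f a), by simp⟩
  exact IsPauliOn.isPauli ((((isPauli_embed f h5).mono (Finset.subset_univ _)).mul
    (isPauliOn_pauliOp (by simp))).smul a)

theorem IsClifford.mul {A B : Op Q} (hA : IsClifford A) (hB : IsClifford B) :
    IsClifford (A * B) := by
  refine ⟨mul_mem hA.1 hB.1, fun W hW => ?_⟩
  have := hA.2 _ (hB.2 W hW)
  simpa only [Matrix.conjTranspose_mul, mul_assoc] using this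

theorem isClifford_one : IsClifford (1 : Op Q) :=
  ⟨one_mem _, fun W hW => by simpa using hW⟩

end Embed

/-! ### Pauli rotations by the angle π/4 -/

section Rotations

variable {Q : Type*} [Fintype Q] [DecidableEq Q]

/-- The rotation `exp (π/4 J)`, for `J ^ 2 = -1`. -/
noncomputable def rot (J : Op Q) : Op Q := ((√2 : ℝ) : ℂ)⁻¹ • (1 + J)

theorem sqrt_two_inv_mul_self : (((√2 : ℝ) : ℂ)⁻¹ * ((√2 : ℝ) : ℂ)⁻¹) = 1 / 2 := by
  rw [← mul_inv, ← Complex.ofReal_mul, Real.mul_self_sqrt (by norm_num)]; norm_num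

theorem rot_mul_rot (J K : Op Q) : rot J * rot K = (1 / 2 : ℂ) • ((1 + J) * (1 + K)) := by
  rw [rot, rot, smul_mul_smul_comm, sqrt_two_inv_mul_self]

theorem rot_mul_rot_neg {J : Op Q} (hJ : J * J = -1) : rot J * rot (-J) = 1 := by
  have : (1 + J) * (1 + -J) = (2 : ℂ) • (1 : Op Q) := by
    rw [mul_add, add_mul, mul_neg, add_mul, hJ, two_smul]; simp; abel
  rw [rot_mul_rot, this, smul_smul]; norm_num

theorem rot_mul_self {J : Op Q} (hJ : J * J = -1) : rot J * rot J = J := by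
  have : (1 + J) * (1 + J) = (2 : ℂ) • J := by
    rw [mul_add, add_mul, add_mul, hJ, two_smul]; simp; abel
  rw [rot_mul_rot, this, smul_smul]; norm_num

/-- Since `L * B * L = B`, conjugation by `rot L` replaces an anticommuting `B` by `L * B`. This is
why Pauli rotations are Clifford and how they move Paulis to each other. -/
theorem rot_mul_of_anticommute {L B : Op Q} (hL : L * L = -1) (h : L * B = -(B * L)) :
    rot L * B = L * B * rot L := by
  have h2 : L * B * L = B := by rw [h, neg_mul, mul_assoc, hL]; simp
  rw [rot, smul_mul_assoc, mul_smul_comm, add_mul, mul_add, h2]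
  simp [add_comm]

theorem rot_mul_rot_of_anticommute {L B : Op Q} (hL : L * L = -1) (h : L * B = -(B * L)) :
    rot L * rot B = rot (L * B) * rot L := by
  have := rot_mul_of_anticommute hL h
  rw [rot.eq_1 B, rot.eq_1 (L * B), mul_smul_comm, smul_mul_assoc, mul_add, add_mul, this]
  simp

theorem commute_rot {J W : Op Q} (h : Commute J W) : Commute (rot J) W :=
  ((Commute.one_left W).add_left h).smul_left _

theorem IsPauli.neg_of_sq {J : Op Q} (hP : IsPauli J) (hJ : J * J = -1) : Jᴴ = -J := by
  have h := hP.mul_conjTranspose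
  calc Jᴴ = -(J * J * Jᴴ) := by rw [hJ]; simp
    _ = -J := by rw [mul_assoc, h, mul_one]

theorem rot_conjTranspose {J : Op Q} (hP : IsPauli J) (hJ : J * J = -1) :
    (rot J)ᴴ = rot (-J) := by
  rw [rot, rot, conjTranspose_smul, conjTranspose_add, hP.neg_of_sq hJ]
  congr 1
  · simp [← Complex.ofReal_inv]
  · simp

theorem isClifford_rot {J : Op Q} (hP : IsPauli J) (hJ : J * J = -1) : IsClifford (rot J) := by
  refine ⟨?_, fun W hW => ?_⟩
  · rw [Matrix.mem_unitaryGroup_iff, Matrix.star_eq_conjTranspose, rot_conjTranspose hP hJ,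
      rot_mul_rot_neg hJ]
  · rw [rot_conjTranspose hP hJ]
    rcases hP.comm hW with h | h
    · rw [(commute_rot h).eq, mul_assoc, rot_mul_rot_neg hJ, mul_one]; exact hW
    · rw [rot_mul_of_anticommute hJ h, mul_assoc, rot_mul_rot_neg hJ, mul_one]; exact hP.mul hW

theorem smul_mul_conjTranspose {u : ℂ} (hu : u * star u = 1) :
    (u • (1 : Op Q)) * (u • (1 : Op Q))ᴴ = 1 := by
  rw [conjTranspose_smul, smul_mul_smul_comm, hu]; simp

theorem isClifford_smul_one {u : ℂ} (hu : u * star u = 1) : IsClifford (u • (1 : Op Q)) := by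
  refine ⟨?_, fun W hW => ?_⟩
  · rw [Matrix.mem_unitaryGroup_iff, Matrix.star_eq_conjTranspose, smul_mul_conjTranspose hu]
  · have : u • (1 : Op Q) * W = W * (u • 1) := by simp
    rw [this, mul_assoc, smul_mul_conjTranspose hu, mul_one]; exact hW

theorem commute_of_support {S : Finset Q} {W : Op Q} (hW : IsPauliOn S W) {P : PauliString Q}
    (hP : ∀ q ∈ S, P q = .I) : Commute W (pauliOp P) := by
  obtain ⟨a, P', hP', rfl⟩ := hW
  refine (pauliOp_commute_of_disjoint fun q => ?_).smul_left _
  by_cases h : q ∈ S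
  · exact .inr (hP q h)
  · exact .inl (hP' q h)

end Rotations

/-! ### Gate counts for Pauli rotations and Pauli operators -/

section Gates

variable {Q : Type*} [Fintype Q] [DecidableEq Q]

theorem isGate_rot {S : Finset Q} (hS : S.card = 1 ∨ S.card = 2) {J : Op Q}
    (hP : IsPauliOn S J) (hJ : J * J = -1) : IsOneOrTwoQubitClifford (rot J) := by
  obtain ⟨a, P, hP, rfl⟩ := hP
  set f : Fin S.card ↪ Q := S.equivFin.symm.toEmbedding.trans (Function.Embedding.subtype _)
    with hf
  have hrange : ∀ q, (∀ a, f a ≠ q) → P q = .I := by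
    intro q hq
    refine hP q fun h => hq (S.equivFin ⟨q, h⟩) ?_
    simp [hf]
  have h1 : Complex.I ^ a • pauliOp P =
      embed f (Complex.I ^ a • pauliOp fun a => P (f a)) := by
    rw [embed_smul, ← pauliOp_eq_embed f P hrange]
  refine ⟨S.card, hS, f, rot (Complex.I ^ a • pauliOp fun a => P (f a)),
    isClifford_rot ⟨a, _, rfl⟩ (embed_injective f ?_), ?_⟩
  · rw [embed_mul, ← h1, hJ, ← embed_one f, ← neg_one_smul ℂ (embed f 1), ← embed_smul,
      neg_one_smul]
  · rw [rot, rot, embed_smul, embed_add, embed_one, ← h1]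

theorem isGate_smul_one [Nonempty Q] {u : ℂ} (hu : u * star u = 1) :
    IsOneOrTwoQubitClifford (u • (1 : Op Q)) := by
  obtain ⟨q⟩ := ‹Nonempty Q›
  exact ⟨1, .inl rfl, ⟨fun _ => q, fun _ _ _ => Subsingleton.elim _ _⟩, u • 1,
    isClifford_smul_one hu, by rw [embed_smul, embed_one]⟩

theorem IsOneOrTwoQubitClifford.isClifford {U : Op Q} (h : IsOneOrTwoQubitClifford U) :
    IsClifford U := by
  obtain ⟨a, -, f, A, hA, rfl⟩ := h; exact hA.embed f

/-- `U` is a product of at most `N` one- and two-qubit Clifford gates. -/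
def Gen (N : ℕ) (U : Op Q) : Prop :=
  ∃ G : List (Op Q), (∀ U ∈ G, IsOneOrTwoQubitClifford U) ∧ G.length ≤ N ∧ G.prod = U

theorem isClifford_list_prod {G : List (Op Q)} (h : ∀ U ∈ G, IsOneOrTwoQubitClifford U) :
    IsClifford G.prod := by
  induction G with
  | nil => exact isClifford_one
  | cons U G ih =>
    rw [List.prod_cons]
    exact (h U (by simp)).isClifford.mul (ih fun V hV => h V (by simp [hV]))

theorem Gen.mono {N N' : ℕ} (h : N ≤ N') {U : Op Q} (hU : Gen N U) : Gen N' U := by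
  obtain ⟨G, h1, h2, h3⟩ := hU; exact ⟨G, h1, h2.trans h, h3⟩

theorem Gen.mul {N N' : ℕ} {U U' : Op Q} (hU : Gen N U) (hU' : Gen N' U') :
    Gen (N + N') (U * U') := by
  obtain ⟨G, h1, h2, rfl⟩ := hU
  obtain ⟨G', h1', h2', rfl⟩ := hU'
  refine ⟨G ++ G', fun U hU => ?_, by simp; omega, by simp⟩
  rcases List.mem_append.mp hU with h | h
  exacts [h1 U h, h1' U h]

theorem gen_one : Gen 0 (1 : Op Q) := ⟨[], by simp, by simp, by simp⟩

theorem IsOneOrTwoQubitClifford.gen {U : Op Q} (h : IsOneOrTwoQubitClifford U) : Gen 1 U :=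
  ⟨[U], by simpa using h, by simp, by simp⟩

theorem gen_smul_one [Nonempty Q] {u : ℂ} (hu : u * star u = 1) : Gen 1 (u • (1 : Op Q)) :=
  (isGate_smul_one hu).gen

theorem Gen.smul [Nonempty Q] {u : ℂ} (hu : u * star u = 1) {N : ℕ} {U : Op Q} (hU : Gen N U) :
    Gen (1 + N) (u • U) := by
  simpa using (gen_smul_one hu).mul hU

/-- A two-qubit rotation reduces the number of qubits on which a Pauli rotation acts. -/
theorem exists_reduction {S : Finset Q} (hS : 2 < S.card) {J : Op Q}
    (hP : IsPauliOn S J) (hJ : J * J = -1) : ∃ q ∈ S, IsPauliOn (S.erase q) J ∨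
      ∃ L J' : Op Q, IsOneOrTwoQubitClifford (rot L) ∧ IsOneOrTwoQubitClifford (rot (-L)) ∧
        IsPauliOn (S.erase q) J' ∧ J' * J' = -1 ∧ rot J = rot L * rot J' * rot (-L) := by
  obtain ⟨a, P, hP, hPJ⟩ := hP
  obtain ⟨q₁, hq₁, q₂, hq₂, hne⟩ := Finset.one_lt_card.mp (show 1 < S.card by omega)
  by_cases hI : P q₂ = .I
  · refine ⟨q₂, hq₂, .inl ⟨a, P, fun q hq => ?_, hPJ⟩⟩
    by_cases h : q = q₂
    · rw [h, hI]
    · exact hP q (by simpa [h] using hq)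
  refine ⟨q₁, hq₁, .inr ?_⟩
  obtain ⟨R, hR⟩ := Pauli.exists_sign_eq_neg_one hI
  -- `K = K₁ * K₂` copies the letter of `J` at `q₁` and has an anticommuting letter at `q₂`. So `K`
  -- anticommutes with `J`, and the product `K * J` is trivial at `q₁`.
  set K₁ : Op Q := pauliOp (single q₁ (P q₁)) with hK₁
  set K₂ : Op Q := pauliOp (single q₂ R) with hK₂
  have hK₁₂ : K₁ * K₂ = K₂ * K₁ := pauliOp_commute_of_disjoint fun q => by
    by_cases h : q = q₁
    · exact .inr (single_of_ne (by rw [h]; exact hne) _)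
    · exact .inl (single_of_ne h _)
  have hsq₁ : K₁ * K₁ = 1 := pauliOp_sq _
  have hsq₂ : K₂ * K₂ = 1 := pauliOp_sq _
  have hJ₁ : J * K₁ = K₁ * J := by
    rw [hPJ, smul_mul_assoc, pauliOp_comm, prod_sign_single]
    simp [Pauli.sign, hK₁]
  have hJ₂ : J * K₂ = -(K₂ * J) := by
    rw [hPJ, smul_mul_assoc, pauliOp_comm, prod_sign_single, hR]
    simp [hK₂]
  set K : Op Q := K₁ * K₂ with hK
  have hKK : K * K = 1 := by
    rw [hK, mul_assoc, ← mul_assoc K₂, ← hK₁₂, mul_assoc K₁, hsq₂, mul_one, hsq₁]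
  have hJK : J * K = -(K * J) := by
    rw [hK, ← mul_assoc, hJ₁, mul_assoc, hJ₂, mul_neg, mul_assoc]
  have hKon : IsPauliOn {q₁, q₂} K :=
    (isPauliOn_single (by simp) _).mul (isPauliOn_single (by simp) _)
  have hcard : ({q₁, q₂} : Finset Q).card = 2 := Finset.card_pair hne
  have hLon : IsPauliOn {q₁, q₂} (-(Complex.I • K)) := hKon.smul_I.neg
  have hLL : -(Complex.I • K) * -(Complex.I • K) = -1 := by
    rw [neg_mul_neg, smul_mul_smul_comm, hKK, Complex.I_mul_I, neg_one_smul]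
  have hKJ : K * (K * J) = J := by rw [← mul_assoc, hKK, one_mul]
  -- The phases make both `L = -iK` and `J' = iKJ` square to -1, with `L * J' = J`; as `L` and `J'`
  -- anticommute, conjugating `rot J'` by `rot L` gives `rot J`.
  refine ⟨-(Complex.I • K), Complex.I • (K * J), isGate_rot (.inr hcard) hLon hLL,
    isGate_rot (.inr hcard) hLon.neg (by rw [neg_mul_neg, hLL]), ?_, ?_, ?_⟩
  · refine IsPauliOn.smul_I ?_
    have h1 : K₁ * pauliOp (Function.update P q₁ .I) = pauliOp P :=
      pauliOp_mul_of_disjoint fun q => by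
        by_cases h : q = q₁
        · subst h; simp
        · simp [single_of_ne h, h]
    have h2 : K * J = Complex.I ^ a • (K₂ * pauliOp (Function.update P q₁ .I)) := by
      rw [hK₁₂, hPJ, ← h1, mul_smul_comm, mul_assoc, ← mul_assoc K₁ K₁, hsq₁, one_mul]
    rw [h2]
    refine ((isPauliOn_single (by simp [hq₂, hne.symm]) _).mul
      (isPauliOn_pauliOp fun q hq => ?_)).smul a
    by_cases h : q = q₁
    · subst h; simp
    · simp only [Function.update_of_ne h]
      exact hP q (by simpa [h] using hq)
  · rw [smul_mul_smul_comm, Complex.I_mul_I, neg_one_smul, mul_assoc K, ← mul_assoc J, hJK,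
      neg_mul, mul_neg, mul_assoc K J, hJ, ← mul_assoc]
    simp [hKK]
  · have h1 : -(Complex.I • K) * (Complex.I • (K * J)) = J := by
      rw [neg_mul, smul_mul_smul_comm, hKJ, Complex.I_mul_I, neg_one_smul, neg_neg]
    have h2 : (Complex.I • (K * J)) * -(Complex.I • K) = -J := by
      rw [mul_neg, smul_mul_smul_comm, mul_assoc, hJK, mul_neg, hKJ, Complex.I_mul_I]
      simp
    rw [rot_mul_rot_of_anticommute hLL (by rw [h1, h2, neg_neg]), h1, mul_assoc,
      rot_mul_rot_neg hLL, mul_one]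

/-- A Pauli rotation on `s` qubits is a product of at most `2 * s + 1` gates. -/
theorem gen_rot {n : ℕ} {S : Finset Q} (hS : S.Nonempty) (hn : S.card ≤ n) {J : Op Q}
    (hP : IsPauliOn S J) (hJ : J * J = -1) : Gen (2 * n + 1) (rot J) := by
  induction n generalizing S J with
  | zero => exact absurd (Finset.card_pos.mpr hS) (by omega)
  | succ n ih =>
    by_cases hcard : 2 < S.card
    · obtain ⟨q, hq, h⟩ := exists_reduction hcard hP hJ
      have h1 : (S.erase q).card = S.card - 1 := Finset.card_erase_of_mem hq
      have h2 : (S.erase q).Nonempty := Finset.card_pos.mp (by omega)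
      rcases h with h | ⟨L, J', hL, hL', hJ'on, hJ', hrot⟩
      · exact (ih h2 (by omega) h hJ).mono (by omega)
      · rw [hrot]
        exact ((hL.gen.mul (ih h2 (by omega) hJ'on hJ')).mul hL'.gen).mono (by omega)
    · have := Finset.card_pos.mpr hS
      exact (isGate_rot (by omega) hP hJ).gen.mono (by omega)

theorem I_mul_star : Complex.I * star Complex.I = 1 := by simp

theorem neg_I_mul_star : -Complex.I * star (-Complex.I) = 1 := by simp

/-- A rotation squares to its generator, so two rotations suffice. If `W * W = 1`, the generator is
`Complex.I • W` and a scalar gate removes the phase. -/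
theorem gen_pauli [Nonempty Q] {n : ℕ} {S : Finset Q} (hS : S.Nonempty) (hn : S.card ≤ n)
    {W : Op Q} (hW : IsPauliOn S W) : Gen (4 * n + 3) W := by
  rcases hW.isPauli.sq with h | h
  · have h1 : (Complex.I • W) * (Complex.I • W) = -1 := by
      rw [smul_mul_smul_comm, h, Complex.I_mul_I, neg_one_smul]
    have h2 := gen_rot hS hn hW.smul_I h1
    have h3 := (h2.mul h2).smul neg_I_mul_star
    rw [rot_mul_self h1, smul_smul] at h3
    simp only [neg_mul, Complex.I_mul_I, neg_neg, one_smul] at h3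
    exact h3.mono (by omega)
  · have h2 := gen_rot hS hn hW h
    have h3 := h2.mul h2
    rw [rot_mul_self h] at h3
    exact h3.mono (by omega)

end Gates

/-! ### Bounded Cliffords as products of gates -/

section Generation

variable {Q : Type*} [Fintype Q] [DecidableEq Q]

/-- `U` commutes with all Pauli operators off `S`. -/
def Fixes (S : Finset Q) (U : Op Q) : Prop :=
  ∀ P : PauliString Q, (∀ q ∈ S, P q = .I) → Commute U (pauliOp P)

theorem Fixes.mul {S : Finset Q} {U U' : Op Q} (h : Fixes S U) (h' : Fixes S U') :
    Fixes S (U * U') := fun P hP => (h P hP).mul_left (h' P hP)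

theorem IsPauliOn.fixes {S : Finset Q} {W : Op Q} (h : IsPauliOn S W) : Fixes S W :=
  fun _ hP => commute_of_support h hP

theorem Fixes.conjTranspose {S : Finset Q} {U : Op Q} (h : Fixes S U) : Fixes S Uᴴ := by
  intro P hP
  have := congrArg Matrix.conjTranspose (h P hP).eq
  rw [Matrix.conjTranspose_mul, Matrix.conjTranspose_mul, pauliOp_conjTranspose] at this
  exact this.symm

theorem IsClifford.mul_conjTranspose {U : Op Q} (h : IsClifford U) : U * Uᴴ = 1 :=
  Matrix.mem_unitaryGroup_iff.mp h.1

theorem IsClifford.conjTranspose_mul {U : Op Q} (h : IsClifford U) : Uᴴ * U = 1 :=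
  Matrix.mem_unitaryGroup_iff'.mp h.1

/-- Conjugation by a Clifford that acts on `S` preserves the Pauli operators on `S`. -/
theorem IsClifford.isPauliOn_conj {S : Finset Q} {U W : Op Q} (hU : IsClifford U)
    (hS : Fixes S U) (hW : IsPauliOn S W) : IsPauliOn S (U * W * Uᴴ) := by
  refine (hU.2 W hW.isPauli).isPauliOn fun q hq p => ?_
  have hP : ∀ q' ∈ S, single q p q' = .I := fun q' hq' =>
    single_of_ne (by rintro rfl; exact hq hq') p
  exact ((hS _ hP).mul_left (hW.fixes _ hP)).mul_left (hS.conjTranspose _ hP)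

/-- Clifford operators that act on `S`, and whose inverse is a product of at most `m` gates. -/
def Reducer (S : Finset Q) (m : ℕ) (W : Op Q) : Prop :=
  IsClifford W ∧ Fixes S W ∧ ∃ W', Gen m W' ∧ W' * W = 1

theorem Reducer.mul {S : Finset Q} {m m' : ℕ} {W W' : Op Q} (h : Reducer S m W)
    (h' : Reducer S m' W') : Reducer S (m + m') (W * W') := by
  obtain ⟨h1, h2, V, h3, h4⟩ := h
  obtain ⟨h1', h2', V', h3', h4'⟩ := h'
  refine ⟨h1.mul h1', h2.mul h2', V' * V, (h3'.mul h3).mono (by omega), ?_⟩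
  rw [mul_assoc, ← mul_assoc V, h4, one_mul, h4']

theorem Reducer.mono {S : Finset Q} {m m' : ℕ} (hm : m ≤ m') {W : Op Q} (h : Reducer S m W) :
    Reducer S m' W := by
  obtain ⟨h1, h2, V, h3, h4⟩ := h
  exact ⟨h1, h2, V, h3.mono hm, h4⟩

theorem reducer_rot {S : Finset Q} (hS : S.Nonempty) {n : ℕ} (hn : S.card ≤ n) {J : Op Q}
    (hP : IsPauliOn S J) (hJ : J * J = -1) : Reducer S (2 * n + 1) (rot J) := by
  refine ⟨isClifford_rot hP.isPauli hJ, fun P h => commute_rot (hP.fixes P h), rot (-J),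
    gen_rot hS hn hP.neg (by rw [neg_mul_neg, hJ]), ?_⟩
  have := rot_mul_rot_neg (J := -J) (by rw [neg_mul_neg, hJ])
  rwa [neg_neg] at this

/-- Pauli group elements on `S` that square to one. -/
def IsInvolutionOn (S : Finset Q) (A : Op Q) : Prop := IsPauliOn S A ∧ A * A = 1

/-- Both `(1 + B * A) * A` and `B * (1 + B * A)` equal `A + B`, so one rotation moves an involution
to any involution that anticommutes with it. -/
theorem exists_reducer_of_anticommute {S : Finset Q} (hS : S.Nonempty) {n : ℕ}
    (hn : S.card ≤ n) {A B : Op Q} (hA : IsInvolutionOn S A) (hB : IsInvolutionOn S B)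
    (h : A * B = -(B * A)) :
    Reducer S (2 * n + 1) (rot (B * A)) ∧ rot (B * A) * A = B * rot (B * A) := by
  have h1 : B * A * (B * A) = -1 := by
    rw [mul_assoc, ← mul_assoc A, h, neg_mul, mul_assoc B A A, hA.2, mul_one, mul_neg, hB.2]
  refine ⟨reducer_rot hS hn (hB.1.mul hA.1) h1, ?_⟩
  have h2 : B * (B * A) = A := by rw [← mul_assoc, hB.2, one_mul]
  rw [rot, smul_mul_assoc, mul_smul_comm, add_mul, mul_add, mul_assoc, hA.2, h2]
  simp [add_comm]

theorem commute_mul_of_anticommute {A B C : Op Q} (hA : C * A = -(A * C))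
    (hB : C * B = -(B * C)) : Commute C (A * B) := by
  show C * (A * B) = A * B * C
  rw [← mul_assoc, hA, neg_mul, mul_assoc, hB, mul_neg, neg_neg, mul_assoc]

theorem anticommute_symm {A B : Op Q} (h : A * B = -(B * A)) : B * A = -(A * B) := by
  rw [h, neg_neg]

/-- Pauli involutions that do not commute with everything can be moved to each other. -/
theorem exists_reducer_map {S : Finset Q} (hS : S.Nonempty) {n : ℕ} (hn : S.card ≤ n)
    {A B X Z : Op Q} (hA : IsInvolutionOn S A) (hB : IsInvolutionOn S B)
    (hX : IsInvolutionOn S X) (hZ : IsInvolutionOn S Z)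
    (hAB : A * B = -(B * A)) (hXZ : X * Z = -(Z * X)) :
    ∃ W, Reducer S (2 * (2 * n + 1)) W ∧ W * A = X * W := by
  -- Two rotations suffice through any `C` anticommuting with both `A` and `X`. One of `B`, `Z` or
  -- `B * Z` (up to phase) is such a `C`.
  have via : ∀ C, IsInvolutionOn S C → A * C = -(C * A) → C * X = -(X * C) →
      ∃ W, Reducer S (2 * (2 * n + 1)) W ∧ W * A = X * W := by
    intro C hC h1 h2
    obtain ⟨h3, h4⟩ := exists_reducer_of_anticommute hS hn hA hC h1
    obtain ⟨h5, h6⟩ := exists_reducer_of_anticommute hS hn hC hX h2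
    refine ⟨_, (h5.mul h3).mono (by omega), ?_⟩
    rw [mul_assoc, h4, ← mul_assoc, h6, mul_assoc]
  rcases hB.1.isPauli.comm hX.1.isPauli with h1 | h1
  swap; · exact via B hB hAB h1
  rcases hA.1.isPauli.comm hZ.1.isPauli with h2 | h2
  swap; · exact via Z hZ h2 (anticommute_symm hXZ)
  have h3 : A * (B * Z) = -(B * Z * A) := by
    rw [← mul_assoc, hAB, neg_mul, mul_assoc, h2, mul_assoc]
  have h4 : B * Z * X = -(X * (B * Z)) := by
    rw [mul_assoc, anticommute_symm hXZ, mul_neg, ← mul_assoc, h1, mul_assoc]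
  have h5 := hB.1.mul hZ.1
  rcases h5.isPauli.sq with h6 | h6
  · exact via _ ⟨h5, h6⟩ h3 h4
  · refine via (Complex.I • (B * Z)) ⟨h5.smul_I, ?_⟩ ?_ ?_
    · rw [smul_mul_smul_comm, h6, Complex.I_mul_I]; simp
    · rw [mul_smul_comm, h3, smul_neg, smul_mul_assoc]
    · rw [smul_mul_assoc, h4, smul_neg, mul_smul_comm]

/-- `B` and `Z` both anticommute with `X`, so the generator `Z * B` of the rotation between them
commutes with `X`. That rotation is available if `B` and `Z` anticommute; otherwise the detour
through `Y = i X Z` uses two rotations, whose generators also commute with `X`. -/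
theorem exists_reducer_map_fixing {S : Finset Q} (hS : S.Nonempty) {n : ℕ} (hn : S.card ≤ n)
    {B X Z : Op Q} (hB : IsInvolutionOn S B) (hX : IsInvolutionOn S X)
    (hZ : IsInvolutionOn S Z) (hXB : X * B = -(B * X)) (hXZ : X * Z = -(Z * X)) :
    ∃ W, Reducer S (2 * (2 * n + 1)) W ∧ W * B = Z * W ∧ Commute W X := by
  rcases hB.1.isPauli.comm hZ.1.isPauli with h | h
  · set Y : Op Q := Complex.I • (X * Z) with hY
    have hXY : X * Y = -(Y * X) := by
      rw [hY, mul_smul_comm, smul_mul_assoc, mul_assoc, anticommute_symm hXZ, mul_neg, smul_neg,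
        neg_neg]
    have hBY : B * Y = -(Y * B) := by
      rw [hY, mul_smul_comm, smul_mul_assoc, ← mul_assoc, anticommute_symm hXB, neg_mul,
        mul_assoc, h, mul_assoc, smul_neg]
    have hYZ : Y * Z = -(Z * Y) := by
      rw [hY, mul_smul_comm, smul_mul_assoc, ← mul_assoc, anticommute_symm hXZ, neg_mul,
        smul_neg, neg_neg]
    have hYi : IsInvolutionOn S Y := by
      refine ⟨(hX.1.mul hZ.1).smul_I, ?_⟩
      rw [hY, smul_mul_smul_comm, mul_assoc, ← mul_assoc Z, anticommute_symm hXZ, neg_mul,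
        mul_assoc, hZ.2, mul_one, mul_neg, hX.2, Complex.I_mul_I]
      simp
    obtain ⟨h1, h2⟩ := exists_reducer_of_anticommute hS hn hB hYi hBY
    obtain ⟨h3, h4⟩ := exists_reducer_of_anticommute hS hn hYi hZ hYZ
    refine ⟨_, (h3.mul h1).mono (by omega), ?_, ?_⟩
    · rw [mul_assoc, h2, ← mul_assoc, h4, mul_assoc]
    · exact (commute_rot (commute_mul_of_anticommute hXZ hXY).symm).mul_left
        (commute_rot (commute_mul_of_anticommute hXY hXB).symm)
  · obtain ⟨h1, h2⟩ := exists_reducer_of_anticommute hS hn hB hZ h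
    exact ⟨_, h1.mono (by omega), h2,
      commute_rot (commute_mul_of_anticommute hXZ hXB).symm⟩

theorem star_mul_self_of_unitary [Nonempty Q] {u : ℂ} (h : IsClifford (u • (1 : Op Q))) :
    u * star u = 1 := by
  have h1 := h.mul_conjTranspose
  rw [conjTranspose_smul, smul_mul_smul_comm, conjTranspose_one, mul_one] at h1
  simpa using congrFun (congrFun h1 fun _ => false) fun _ => false

theorem pauliOp_single_Y (q : Q) :
    pauliOp (single q .Y) = Complex.I • (pauliOp (single q .X) * pauliOp (single q .Z)) := by
  rw [pauliOp_mul, smul_smul]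
  have h1 : (fun q' => Pauli.mul (single q .X q') (single q .Z q')) = single q .Y := by
    funext q'
    by_cases h : q' = q
    · subst h; simp [Pauli.mul]
    · simp [single_of_ne h, Pauli.mul]
  have h2 : (∑ q', Pauli.phase (single q .X q') (single q .Z q')) = 3 := by
    rw [Finset.sum_eq_single q]
    · simp [Pauli.phase]
    · intro q' _ h; simp [single_of_ne h, Pauli.phase]
    · simp
  rw [h1, h2, ← pow_succ', Complex.I_pow_four, one_smul]

theorem single_I (q : Q) : pauliOp (single q .I) = 1 := by
  rw [show single q Pauli.I = fun _ => .I by simp [single], pauliOp_one]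

theorem pauliOp_single_mul_update (P : PauliString Q) (q : Q) :
    pauliOp (single q (P q)) * pauliOp (Function.update P q .I) = pauliOp P :=
  pauliOp_mul_of_disjoint fun q' => by
    by_cases h : q' = q
    · subst h; simp
    · simp [single_of_ne h, h]

/-- A Clifford operator acting on a set `S` of at most `n` qubits is a product of at most
`4 * (2 * n + 1) * |S| + 1` one- and two-qubit Clifford gates. -/
theorem IsClifford.gen [Nonempty Q] {n : ℕ} {S : Finset Q} (hn : S.card ≤ n) {U : Op Q}
    (hU : IsClifford U) (hS : Fixes S U) : Gen (4 * (2 * n + 1) * S.card + 1) U := by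
  induction S using Finset.induction_on generalizing U with
  | empty =>
    -- With no qubit left the operator is a phase, which is the one extra gate in the bound.
    obtain ⟨u, rfl⟩ := eq_smul_one_of_commute fun P => hS P (by simp)
    simpa using gen_smul_one (star_mul_self_of_unitary hU)
  | insert q S hq ih =>
    rw [Finset.card_insert_of_notMem hq] at hn ⊢
    set T := insert q S with hT
    have hTn : T.card ≤ n := by rw [hT, Finset.card_insert_of_notMem hq]; exact hn
    have hTne : T.Nonempty := ⟨q, by simp [hT]⟩
    set X : Op Q := pauliOp (single q .X) with hXdef
    set Z : Op Q := pauliOp (single q .Z) with hZdef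
    have hX : IsInvolutionOn T X := ⟨isPauliOn_single (by simp [hT]) _, pauliOp_sq _⟩
    have hZ : IsInvolutionOn T Z := ⟨isPauliOn_single (by simp [hT]) _, pauliOp_sq _⟩
    have hXZ : X * Z = -(Z * X) := by
      rw [hXdef, hZdef, pauliOp_comm, prod_sign_single]; simp [Pauli.sign]
    have hconj : ∀ {V A : Op Q}, IsClifford V → Fixes T V → IsInvolutionOn T A →
        IsInvolutionOn T (V * A * Vᴴ) := by
      intro V A hV hVT hA
      refine ⟨hV.isPauliOn_conj hVT hA.1, ?_⟩
      calc V * A * Vᴴ * (V * A * Vᴴ) = V * A * (Vᴴ * V) * A * Vᴴ := by simp only [mul_assoc]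
        _ = V * (A * A) * Vᴴ := by rw [hV.conjTranspose_mul]; simp only [mul_assoc, mul_one]
        _ = 1 := by rw [hA.2, mul_one, hV.mul_conjTranspose]
    have hmul : ∀ {V A B : Op Q}, IsClifford V →
        V * A * Vᴴ * (V * B * Vᴴ) = V * (A * B) * Vᴴ := by
      intro V A B hV
      calc V * A * Vᴴ * (V * B * Vᴴ) = V * A * (Vᴴ * V) * B * Vᴴ := by simp only [mul_assoc]
        _ = _ := by rw [hV.conjTranspose_mul]; simp only [mul_assoc, mul_one]
    have hmove : ∀ {V A : Op Q}, IsClifford V → V * A = V * A * Vᴴ * V := by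
      intro V A hV; rw [mul_assoc _ Vᴴ, hV.conjTranspose_mul, mul_one]
    -- `W₁` moves the image of `X` under `U` back to `X`, and `W₂` then moves the image of `Z` back
    -- to `Z` while keeping `X`. So `W₂ * W₁ * U` acts trivially on `q` and the induction continues
    -- on `S`; each of the two costs `2 * (2 * n + 1)`.
    obtain ⟨W₁, hW₁, hW₁X⟩ := exists_reducer_map hTne hTn (hconj hU hS hX) (hconj hU hS hZ) hX hZ
      (by rw [hmul hU, hmul hU, hXZ]; simp) hXZ
    have hV := hW₁.1.mul hU
    have hVT := hW₁.2.1.mul hS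
    have hVX : W₁ * U * X = X * (W₁ * U) := by
      rw [mul_assoc, hmove hU, ← mul_assoc, hW₁X, mul_assoc]
    have hVX' : W₁ * U * X * (W₁ * U)ᴴ = X := by
      rw [hVX, mul_assoc, hV.mul_conjTranspose, mul_one]
    obtain ⟨W₂, hW₂, hW₂Z, hW₂X⟩ := exists_reducer_map_fixing hTne hTn (hconj hV hVT hZ) hX hZ
      (by
        have h1 := hmul (A := X) (B := Z) hV
        have h2 := hmul (A := Z) (B := X) hV
        rw [hVX'] at h1 h2
        rw [h1, h2, hXZ]; simp) hXZ
    have hW := hW₂.mul hW₁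
    obtain ⟨W', hW', hWW⟩ := hW.2.2
    have hWX : Commute (W₂ * (W₁ * U)) X := by
      show _ * _ = _ * _
      rw [mul_assoc, hVX, ← mul_assoc, hW₂X.eq, mul_assoc]
    have hWZ : Commute (W₂ * (W₁ * U)) Z := by
      show _ * _ = _ * _
      rw [mul_assoc, hmove hV, ← mul_assoc, hW₂Z, mul_assoc]
    have hfix : Fixes S (W₂ * (W₁ * U)) := by
      intro P hP
      rw [← pauliOp_single_mul_update P q]
      refine Commute.mul_right ?_ ((hW₂.2.1.mul hVT) _ fun q' hq' => ?_)
      · cases P q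
        · rw [single_I]
          exact Commute.one_right _
        · exact hWX
        · rw [pauliOp_single_Y]; exact (hWX.mul_right hWZ).smul_right _
        · exact hWZ
      · by_cases h : q' = q
        · subst h; simp
        · simp only [Function.update_of_ne h]
          exact hP q' (by simpa [hT, h] using hq')
    have h1 := hW'.mul (ih (by omega) (hW₂.1.mul hV) hfix)
    have h2 : W' * (W₂ * (W₁ * U)) = U := by
      rw [← mul_assoc W₂, ← mul_assoc, hWW, one_mul]
    rw [h2] at h1
    exact h1.mono (by ring_nf; omega)

end Generation

/-! ### Algebra and gate counts of controlled operators -/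

section Controlled

variable {Q : Type*} [Fintype Q] [DecidableEq Q]

theorem proj_false (c : Q) :
    proj c false = (1 / 2 : ℂ) • (1 + pauliOp (single c .Z)) := by
  rw [pauliOp_single_Z, proj, ← Matrix.diagonal_one, Matrix.diagonal_add, ← Matrix.diagonal_smul]
  congr 1; funext x; cases h : x c <;> norm_num [h]

theorem proj_true (c : Q) :
    proj c true = (1 / 2 : ℂ) • (1 - pauliOp (single c .Z)) := by
  rw [pauliOp_single_Z, proj, ← Matrix.diagonal_one, Matrix.diagonal_sub, ← Matrix.diagonal_smul]
  congr 1; funext x; cases h : x c <;> norm_num [h]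

theorem proj_false_eq (c : Q) : proj c false = 1 - proj c true := by
  rw [proj_false, proj_true]; module

theorem proj_mul_self (c : Q) (b : Bool) : proj c b * proj c b = proj c b := by
  rw [proj, Matrix.diagonal_mul_diagonal]; congr 1; funext x; simp

theorem controlled_one (c : Q) : controlled c 1 = 1 := by
  rw [controlled, proj_false_eq]; simp

theorem controlled_mul {c : Q} {U W : Op Q} (hU : Commute (proj c true) U) :
    controlled c U * controlled c W = controlled c (U * W) := by
  have h0 : proj c true * proj c true = proj c true := proj_mul_self c true
  have h1 : proj c true * U * proj c true = proj c true * U := by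
    rw [hU.eq, mul_assoc, h0]
  simp only [controlled, proj_false_eq, mul_add, add_mul, mul_sub, sub_mul, mul_one, one_mul, h0,
    h1, ← mul_assoc]
  abel

theorem commute_controlled {c : Q} {g U : Op Q} (h : Commute g (proj c true))
    (hU : Commute g U) : Commute g (controlled c U) := by
  rw [controlled, proj_false_eq]
  exact ((Commute.one_right g).sub_right h).add_right (h.mul_right hU)

theorem mul_controlled {c : Q} {g W W' : Op Q} (h : Commute g (proj c true))
    (hW : g * W = W' * g) : g * controlled c W = controlled c W' * g := by
  have h0 : g * (proj c true * W) = proj c true * (W' * g) := by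
    rw [← mul_assoc, h.eq, mul_assoc, hW]
  rw [controlled, controlled, proj_false_eq, mul_add, add_mul, mul_sub, sub_mul, h0, h.eq]
  simp only [mul_one, one_mul, mul_assoc]

/-- The basic propagation rule: only the branch in which the control is 1 applies `U`, so the
commutator `K` of `U` and `W` appears as an error controlled by the same qubit. -/
theorem controlled_mul_eq {c : Q} {U W K : Op Q} (hW : Commute (proj c true) W)
    (hK : Commute (proj c true) K) (h : U * W = W * K * U) :
    controlled c U * W = W * controlled c K * controlled c U := by
  have h0 : proj c true * (W * K * U) = W * (proj c true * (K * U)) := by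
    rw [mul_assoc W, ← mul_assoc, hW.eq, mul_assoc]
  rw [mul_assoc, controlled_mul hK, controlled, controlled, proj_false_eq, mul_add, add_mul,
    mul_assoc _ U W, h, h0, sub_mul, mul_sub, hW.eq, one_mul, mul_one]

/-- An `X` error on the control of a gate. -/
theorem controlled_mul_X {c : Q} {U : Op Q} (hU : Commute (proj c true) U)
    (hX : Commute U (pauliOp (single c .X))) {u : ℂ} (hu : u * star u = 1) (hUU : U * U = u • 1) :
    controlled c U * pauliOp (single c .X) =
      U * pauliOp (single c .X) * controlled c (star u • (1 : Op Q)) * controlled c U := by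
  set X := pauliOp (single c .X) with hXdef
  have hZX : pauliOp (single c .Z) * X = -(X * pauliOp (single c .Z)) := by
    rw [hXdef, pauliOp_comm, prod_sign_single]; simp [Pauli.sign]
  -- `X` exchanges the two branches of the control, so `U` is applied in the wrong one. Multiplying
  -- by `U` repairs one branch and leaves `U * U = u` in the other, which the controlled phase `star
  -- u` cancels.
  have hXp : X * proj c true = proj c false * X := by
    rw [proj_true, proj_false, mul_smul_comm, smul_mul_assoc, mul_sub, add_mul, hZX]
    simp [sub_eq_add_neg]
  have hXp' : X * proj c false = proj c true * X := by
    rw [proj_true, proj_false, mul_smul_comm, smul_mul_assoc, mul_add, sub_mul, hZX]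
    simp
  have hUp : Commute (proj c false) U := by
    rw [proj_false_eq]; exact (Commute.one_left U).sub_left hU
  rw [mul_assoc _ (controlled c _), controlled_mul ((Commute.one_right _).smul_right _)]
  simp only [smul_mul_assoc, one_mul]
  rw [controlled, controlled, mul_add, add_mul, mul_assoc U X (proj c false), hXp', ← mul_assoc U,
    ← hU.eq]
  have h1 : U * X * (proj c true * star u • U) = proj c false * X := by
    calc U * X * (proj c true * star u • U) = star u • (U * (X * proj c true) * U) := by
          simp only [mul_smul_comm, mul_assoc]
      _ = star u • (proj c false * U * (X * U)) := by
          rw [hXp, ← mul_assoc, ← hUp.eq]; simp only [mul_assoc]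
      _ = star u • (proj c false * (U * U) * X) := by rw [← hX.eq]; simp only [mul_assoc]
      _ = _ := by
          rw [hUU, mul_smul_comm, mul_one, smul_mul_assoc, smul_smul, mul_comm, hu, one_smul]
  rw [h1]; abel

theorem one_add_I_phase : ((1 + Complex.I) * ((√2 : ℝ) : ℂ)⁻¹) *
    star ((1 + Complex.I) * ((√2 : ℝ) : ℂ)⁻¹) = 1 := by
  have h1 : star ((1 + Complex.I) * ((√2 : ℝ) : ℂ)⁻¹) = (1 - Complex.I) * ((√2 : ℝ) : ℂ)⁻¹ := by
    simp [sub_eq_add_neg]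
  rw [h1, mul_mul_mul_comm, sqrt_two_inv_mul_self]
  have : (1 + Complex.I) * (1 - Complex.I) = 2 := by
    ring_nf; rw [Complex.I_sq]; norm_num
  rw [this]; norm_num

/-- The controlled operator is `(1 + Z + W - Z W) / 2`. It is the product of the π/4 rotations about
the commuting involutions `Z`, `W` and `Z W`, up to the phase `(1 + i) / √2`. -/
theorem controlled_eq_rot {c : Q} {W : Op Q} (hW : W * W = 1)
    (hZW : pauliOp (single c .Z) * W = W * pauliOp (single c .Z)) :
    controlled c W = ((1 + Complex.I) * ((√2 : ℝ) : ℂ)⁻¹) •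
      (rot (-(Complex.I • pauliOp (single c .Z))) * rot (-(Complex.I • W)) *
        rot (Complex.I • (pauliOp (single c .Z) * W))) := by
  have hZZ : pauliOp (single c .Z) * pauliOp (single c .Z) = 1 := pauliOp_sq _
  rw [controlled, proj_false, proj_true]
  set Z := pauliOp (single c .Z)
  have h1 : Z * (Z * W) = W := by rw [← mul_assoc, hZZ, one_mul]
  have h2 : W * (Z * W) = Z := by rw [hZW, ← mul_assoc, hW, one_mul]
  have e : (1 + -(Complex.I • Z)) * (1 + -(Complex.I • W)) * (1 + Complex.I • (Z * W)) =
      (1 - Complex.I) • (1 + Z + W - Z * W) := by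
    simp only [mul_add, add_mul, one_mul, mul_one, neg_mul, mul_neg, smul_mul_assoc,
      mul_smul_comm, mul_assoc, h1, h2, hZZ]
    match_scalars <;> ring_nf <;> simp <;> ring
  rw [rot, rot, rot, smul_mul_smul_comm, smul_mul_smul_comm, sqrt_two_inv_mul_self, e, smul_smul,
    smul_smul]
  have h4 : (1 + Complex.I) * ((√2 : ℝ) : ℂ)⁻¹ * (1 / 2 * ((√2 : ℝ) : ℂ)⁻¹ * (1 - Complex.I)) =
      1 / 2 := by
    have : (1 + Complex.I) * ((√2 : ℝ) : ℂ)⁻¹ * (1 / 2 * ((√2 : ℝ) : ℂ)⁻¹ * (1 - Complex.I)) =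
      (1 / 2) * (((√2 : ℝ) : ℂ)⁻¹ * ((√2 : ℝ) : ℂ)⁻¹) * (1 - Complex.I ^ 2) := by ring
    rw [this, sqrt_two_inv_mul_self, Complex.I_sq]; norm_num
  rw [← mul_assoc] at h4
  rw [h4, smul_mul_assoc, ← smul_add]
  congr 1
  rw [sub_mul, one_mul]; abel

theorem controlled_I_eq_rot {c : Q} :
    controlled c (Complex.I • (1 : Op Q)) = ((1 + Complex.I) * ((√2 : ℝ) : ℂ)⁻¹) •
      rot (-(Complex.I • pauliOp (single c .Z))) := by
  rw [controlled, proj_false, proj_true, rot, smul_smul, mul_assoc, sqrt_two_inv_mul_self]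
  set Z := pauliOp (single c .Z)
  simp only [mul_smul_comm, mul_one]
  match_scalars <;> ring_nf
  rw [Complex.I_sq]; ring

theorem gen_controlled_I [Nonempty Q] (c : Q) : Gen 4 (controlled c (Complex.I • (1 : Op Q))) := by
  have hZ : IsPauliOn {c} (-(Complex.I • pauliOp (single c .Z))) :=
    (isPauliOn_single (by simp) _).smul_I.neg
  have hZZ : -(Complex.I • pauliOp (single c .Z)) * -(Complex.I • pauliOp (single c .Z)) = -1 := by
    rw [neg_mul_neg, smul_mul_smul_comm, pauliOp_sq, Complex.I_mul_I, neg_one_smul]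
  rw [controlled_I_eq_rot]
  exact ((gen_rot (n := 1) (by simp) (by simp) hZ hZZ).smul one_add_I_phase).mono (by omega)

theorem commute_Z_of_notMem {S : Finset Q} {c : Q} (hc : c ∉ S) {W : Op Q} (hW : IsPauliOn S W)
    (p : Pauli) : Commute W (pauliOp (single c p)) :=
  hW.fixes _ fun q hq => single_of_ne (by rintro rfl; exact hc hq) p

/-- The cost of a controlled Pauli operator on `n` qubits. -/
def ctlCost (n : ℕ) : ℕ := 8 * n + 14

/-- A controlled Pauli operator is a product of boundedly many gates. -/
theorem gen_controlled [Nonempty Q] {n : ℕ} {S : Finset Q} (hn : S.card ≤ n) {c : Q} (hc : c ∉ S)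
    {W : Op Q} (hW : IsPauliOn S W) : Gen (ctlCost n) (controlled c W) := by
  have main : ∀ {W : Op Q}, IsPauliOn S W → W * W = 1 → Gen (6 * n + 10) (controlled c W) := by
    intro W hW hWW
    have hWi : IsPauliOn (insert c S) W := hW.mono (by simp)
    have hZi : IsPauliOn (insert c S) (pauliOp (single c .Z)) := isPauliOn_single (by simp) _
    have hZW := (commute_Z_of_notMem hc hW .Z).eq
    have hZZ : pauliOp (single c .Z) * pauliOp (single c .Z) = 1 := pauliOp_sq _
    rw [controlled_eq_rot hWW hZW.symm]
    have hcard : (insert c S).card ≤ n + 1 := by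
      rw [Finset.card_insert_of_notMem hc]; omega
    have hne : (insert c S).Nonempty := ⟨c, by simp⟩
    have g1 := gen_rot hne hcard hZi.smul_I.neg
      (by rw [neg_mul_neg, smul_mul_smul_comm, hZZ, Complex.I_mul_I, neg_one_smul])
    have g2 := gen_rot hne hcard hWi.smul_I.neg
      (by rw [neg_mul_neg, smul_mul_smul_comm, hWW, Complex.I_mul_I, neg_one_smul])
    have g3 := gen_rot hne hcard (hZi.mul hWi).smul_I
      (by rw [smul_mul_smul_comm, mul_assoc, ← mul_assoc W, hZW, mul_assoc, hWW, mul_one, hZZ,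
        Complex.I_mul_I, neg_one_smul])
    exact (((g1.mul g2).mul g3).smul one_add_I_phase).mono (by omega)
  rcases hW.isPauli.sq with h | h
  · exact (main hW h).mono (by unfold ctlCost; omega)
  · have h1 : -(Complex.I • W) * -(Complex.I • W) = 1 := by
      rw [neg_mul_neg, smul_mul_smul_comm, h, Complex.I_mul_I]; simp
    -- If `W` squares to -1, then `-i W` is an involution, and the missing factor `i` becomes a
    -- phase gate on the control.
    have h2 : controlled c W = controlled c (Complex.I • (1 : Op Q)) *
        controlled c (-(Complex.I • W)) := by
      rw [controlled_mul ((Commute.one_right _).smul_right _), mul_neg, smul_mul_smul_comm,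
        one_mul, Complex.I_mul_I]
      simp
    rw [h2]
    exact ((gen_controlled_I c).mul (main hW.smul_I.neg h1)).mono (by unfold ctlCost; omega)

theorem controlled_neg_one (c : Q) :
    controlled c ((-1 : ℂ) • (1 : Op Q)) = pauliOp (single c .Z) := by
  rw [controlled, proj_false, proj_true]
  simp only [mul_smul_comm, mul_one]
  module

/-- The only signs that occur give the identity, a CZ, or a `Z` if the controls coincide. The
constant is `ctlCost 1 = 22`, the price of a CZ, and recurs in all later bounds. -/
theorem gen_controlled_controlled_sign [Nonempty Q] (c c' : Q) {ε : ℂ} (hε : ε = 1 ∨ ε = -1) :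
    Gen 22 (controlled c (controlled c' (ε • (1 : Op Q)))) := by
  rcases hε with rfl | rfl
  · rw [one_smul, controlled_one, controlled_one]; exact gen_one.mono (by omega)
  · rw [controlled_neg_one]
    by_cases h : c = c'
    · subst h
      have h1 : controlled c (pauliOp (single c .Z)) =
          controlled c ((-1 : ℂ) • (1 : Op Q)) := by
        rw [controlled, controlled]
        congr 1
        rw [proj_true, smul_mul_assoc, smul_mul_assoc, sub_mul, pauliOp_sq]
        simp
      rw [h1, controlled_neg_one]
      exact (gen_pauli (n := 1) (S := {c}) (by simp) (by simp)
        (isPauliOn_single (by simp) _)).mono (by omega)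
    · exact gen_controlled (n := 1) (S := {c'}) (by simp) (by simpa using h)
        (isPauliOn_single (by simp) _)

end Controlled

/-! ### Ancilla-diagonal errors and commutation up to them -/

section Propagation

variable {D A : Type*} [Fintype D] [DecidableEq D] [Fintype A] [DecidableEq A]

/-- Operators that are diagonal, and depend on the ancillas only. -/
def AncDiag (E : Op (D ⊕ A)) : Prop :=
  ∃ φ : (A → Bool) → ℂ, E = Matrix.diagonal fun x => φ fun a => x (.inr a)

theorem AncDiag.mul {E E' : Op (D ⊕ A)} (h : AncDiag E) (h' : AncDiag E') :
    AncDiag (E * E') := by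
  obtain ⟨φ, rfl⟩ := h
  obtain ⟨φ', rfl⟩ := h'
  exact ⟨fun z => φ z * φ' z, by rw [Matrix.diagonal_mul_diagonal]⟩

theorem AncDiag.add {E E' : Op (D ⊕ A)} (h : AncDiag E) (h' : AncDiag E') :
    AncDiag (E + E') := by
  obtain ⟨φ, rfl⟩ := h
  obtain ⟨φ', rfl⟩ := h'
  exact ⟨fun z => φ z + φ' z, by rw [Matrix.diagonal_add]⟩

theorem ancDiag_smul_one (u : ℂ) : AncDiag (u • (1 : Op (D ⊕ A))) :=
  ⟨fun _ => u, by rw [← Matrix.diagonal_one, ← Matrix.diagonal_smul]; congr 1; funext; simp⟩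

theorem ancDiag_one : AncDiag (1 : Op (D ⊕ A)) := by simpa using ancDiag_smul_one (D := D) (A := A) 1

theorem ancDiag_proj (a : A) (b : Bool) : AncDiag (proj (.inr a : D ⊕ A) b) :=
  ⟨fun z => if z a = b then 1 else 0, rfl⟩

theorem AncDiag.controlled {E : Op (D ⊕ A)} (h : AncDiag E) (a : A) :
    AncDiag (PSCProtocol.controlled (.inr a) E) :=
  (ancDiag_proj a false).add ((ancDiag_proj a true).mul h)

/-- Operators that are block diagonal in the computational basis of the ancillas. -/
def BlockDiag (Y : Op (D ⊕ A)) : Prop := ∀ E, AncDiag E → Commute E Y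

theorem BlockDiag.mul {Y Y' : Op (D ⊕ A)} (h : BlockDiag Y) (h' : BlockDiag Y') :
    BlockDiag (Y * Y') := fun E hE => (h E hE).mul_right (h' E hE)

theorem BlockDiag.proj {Y : Op (D ⊕ A)} (h : BlockDiag Y) (a : A) :
    Commute (proj (.inr a) true) Y := h _ (ancDiag_proj a true)

theorem AncDiag.blockDiag {E : Op (D ⊕ A)} (h : AncDiag E) : BlockDiag E := by
  rintro _ ⟨φ', rfl⟩
  obtain ⟨φ, rfl⟩ := h
  show _ * _ = _ * _
  rw [Matrix.diagonal_mul_diagonal, Matrix.diagonal_mul_diagonal]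
  congr 1; funext x; exact mul_comm _ _

theorem blockDiag_one : BlockDiag (1 : Op (D ⊕ A)) := ancDiag_one.blockDiag

theorem BlockDiag.controlled {Y : Op (D ⊕ A)} (h : BlockDiag Y) (a : A) :
    BlockDiag (PSCProtocol.controlled (.inr a) Y) := fun E hE =>
  commute_controlled ((ancDiag_proj a true).blockDiag E hE) (h E hE)

theorem blockDiag_embed {R : Type*} [Fintype R] (f : R ↪ D) (B : Op R) :
    BlockDiag (embed (f.trans (Function.Embedding.inl : D ↪ D ⊕ A)) B) := by
  rintro _ ⟨φ, rfl⟩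
  show _ * _ = _ * _
  ext x y
  rw [Matrix.diagonal_mul, Matrix.mul_diagonal]
  simp only [embed, Matrix.of_apply]
  split_ifs with h
  · have : (fun a : A => x (.inr a)) = fun a => y (.inr a) :=
      funext fun a => h (.inr a) (by simp)
    rw [this, mul_comm]
  · simp

theorem IsPauliOn.blockDiag {S : Finset D} {W : Op (D ⊕ A)}
    (hW : IsPauliOn (S.map Function.Embedding.inl) W) : BlockDiag W := by
  obtain ⟨a, P, hP, rfl⟩ := hW
  intro E hE
  refine Commute.smul_right ?_ _
  rw [pauliOp_eq_embed ((Function.Embedding.refl D).trans (Function.Embedding.inl : D ↪ D ⊕ A)) P]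
  · exact blockDiag_embed _ _ E hE
  · intro q hq
    refine hP q fun h => ?_
    obtain ⟨d, -, rfl⟩ := Finset.mem_map.mp h
    exact hq d rfl

/-- The gate `g` commutes with `Y` up to a diagonal operator on the ancillas that is a product
of at most `N` gates. -/
def Twist (g : Op (D ⊕ A)) (N : ℕ) (Y : Op (D ⊕ A)) : Prop :=
  ∃ E, AncDiag E ∧ Gen N E ∧ g * Y = Y * E * g

theorem Twist.mul {g Y Y' : Op (D ⊕ A)} {N N' : ℕ} (h : Twist g N Y) (h' : Twist g N' Y')
    (hY' : BlockDiag Y') : Twist g (N + N') (Y * Y') := by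
  obtain ⟨E, h1, h2, h3⟩ := h
  obtain ⟨E', h1', h2', h3'⟩ := h'
  refine ⟨E * E', h1.mul h1', h2.mul h2', ?_⟩
  calc g * (Y * Y') = Y * E * (g * Y') := by rw [← mul_assoc, h3, mul_assoc]
    _ = Y * (E * Y') * E' * g := by rw [h3']; simp only [mul_assoc]
    _ = _ := by rw [(hY' E h1).eq]; simp only [mul_assoc]

theorem AncDiag.twist {g E : Op (D ⊕ A)} (hg : BlockDiag g) (hE : AncDiag E) : Twist g 0 E :=
  ⟨1, ancDiag_one, gen_one, by rw [mul_one, (hg E hE).eq]⟩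

theorem Twist.mono {g Y : Op (D ⊕ A)} {N N' : ℕ} (hN : N ≤ N') (h : Twist g N Y) :
    Twist g N' Y := by
  obtain ⟨E, h1, h2, h3⟩ := h; exact ⟨E, h1, h2.mono hN, h3⟩

/-- Applying `controlled_mul_eq` inside a second control shows that two controlled operators with
commuting or anticommuting targets commute up to a CZ of their controls. -/
theorem twist_controlled [Nonempty D] {a b : A} {U W : Op (D ⊕ A)} (hU : BlockDiag U)
    (hW : BlockDiag W) {ε : ℂ} (hε : ε = 1 ∨ ε = -1) (h : U * W = ε • (W * U)) :
    Twist (controlled (.inr b) U) 22 (controlled (.inr a) W) := by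
  have h1 : controlled (.inr b) U * W =
      W * controlled (.inr b) (ε • 1) * controlled (.inr b) U :=
    controlled_mul_eq (hW.proj b) ((Commute.one_right _).smul_right _) (by simp [h])
  refine ⟨controlled (.inr a) (controlled (.inr b) (ε • 1)),
    ((ancDiag_smul_one ε).controlled b).controlled a, gen_controlled_controlled_sign _ _ hε, ?_⟩
  rw [mul_controlled ((hU.controlled b).proj a).symm h1, controlled_mul (hW.proj a)]

theorem IsPauli.exists_sign {A B : Op D} (hA : IsPauli A) (hB : IsPauli B) :
    ∃ ε : ℂ, (ε = 1 ∨ ε = -1) ∧ A * B = ε • (B * A) := by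
  rcases hA.comm hB with h | h
  · exact ⟨1, .inl rfl, by simp [h]⟩
  · exact ⟨-1, .inr rfl, by simp [h]⟩

/-- Here `V` need not be Pauli: the identity gives `V * K = K * V * (K * K)`, and a Pauli squares to
a sign. -/
theorem IsPauli.exists_sign_of_mul_mul {V K : Op D} (hK : IsPauli K) (h : K * V * K = V) :
    ∃ ε : ℂ, (ε = 1 ∨ ε = -1) ∧ V * K = ε • (K * V) := by
  have h1 : V * K = K * V * (K * K) := by
    conv_lhs => rw [← h]
    simp only [mul_assoc]
  rcases hK.sq with h2 | h2
  · exact ⟨1, .inl rfl, by rw [h1, h2]; simp⟩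
  · exact ⟨-1, .inr rfl, by rw [h1, h2]; simp⟩

/-! ### Clifford roots of scalars and circuits seen from one block -/

/-- Clifford operators on the data qubits in `S` that square to a power of `i`. -/
structure IsRootOn (S : Finset D) (V : Op (D ⊕ A)) : Prop where
  clifford : IsClifford V
  fixes : Fixes (S.map Function.Embedding.inl) V
  blockDiag : BlockDiag V
  sq : ∃ b : ℕ, V * V = Complex.I ^ b • 1

namespace IsRootOn

variable {S : Finset D} {V : Op (D ⊕ A)} (hV : IsRootOn S V)
include hV

theorem conjTranspose_mul_conjTranspose {b : ℕ} (hb : V * V = Complex.I ^ b • 1) :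
    Vᴴ * Vᴴ = star (Complex.I ^ b) • 1 := by
  rw [← Matrix.conjTranspose_mul, hb, conjTranspose_smul, conjTranspose_one]

theorem eq_smul_conjTranspose {b : ℕ} (hb : V * V = Complex.I ^ b • 1) :
    V = Complex.I ^ b • Vᴴ := by
  calc V = V * V * Vᴴ := by rw [mul_assoc, hV.clifford.mul_conjTranspose, mul_one]
    _ = _ := by rw [hb, smul_mul_assoc, one_mul]

/-- Because `V * V` is a scalar, the product collapses; this is the point where the scalar square
makes the commutator of `P` and `V` commute or anticommute with `V`. -/
theorem mul_mul_eq {P : Op (D ⊕ A)} (hP : P * P = 1) :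
    P * (V * P * Vᴴ) * V * (P * (V * P * Vᴴ)) = V := by
  obtain ⟨b, hb⟩ := hV.sq
  have h := hV.clifford.conjTranspose_mul
  calc P * (V * P * Vᴴ) * V * (P * (V * P * Vᴴ))
      = P * V * P * (Vᴴ * V) * P * V * P * Vᴴ := by simp only [mul_assoc]
    _ = P * V * (P * P) * V * P * Vᴴ := by rw [h, mul_one]; simp only [mul_assoc]
    _ = P * (V * V) * P * Vᴴ := by rw [hP, mul_one]; simp only [mul_assoc]
    _ = Complex.I ^ b • (P * P * Vᴴ) := by rw [hb]; simp
    _ = V := by rw [hP, one_mul]; exact (hV.eq_smul_conjTranspose hb).symm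

theorem mul_mul_eq' {P : Op (D ⊕ A)} (hP : P * P = 1) :
    V * P * Vᴴ * P * V * (V * P * Vᴴ * P) = V := by
  obtain ⟨b, hb⟩ := hV.sq
  calc V * P * Vᴴ * P * V * (V * P * Vᴴ * P)
      = V * P * Vᴴ * P * (V * V) * P * Vᴴ * P := by simp only [mul_assoc]
    _ = Complex.I ^ b • (V * P * Vᴴ * (P * P) * Vᴴ * P) := by
        rw [hb]; simp only [mul_smul_comm, smul_mul_assoc, mul_one, mul_assoc]
    _ = Complex.I ^ b • (V * P * (Vᴴ * Vᴴ) * P) := by rw [hP, mul_one]; simp only [mul_assoc]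
    _ = V * (P * P) := by
        rw [hV.conjTranspose_mul_conjTranspose hb]
        simp only [mul_smul_comm, smul_mul_assoc, mul_one, smul_smul, I_pow_mul_conj, one_smul,
          mul_assoc]
    _ = V := by rw [hP, mul_one]

/-- `V` and `Vᴴ` differ by a scalar, so they conjugate in the same way. -/
theorem mul_conj {P : Op (D ⊕ A)} : P * V = V * (V * P * Vᴴ) := by
  obtain ⟨b, hb⟩ := hV.sq
  rw [← mul_assoc, ← mul_assoc, hb]
  conv_lhs => rw [hV.eq_smul_conjTranspose hb]
  simp

end IsRootOn

/-- Circuits with `ρ` gates `C(V)`, `β` controlled Pauli gates on the data qubits in `S`, and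
other gates that commute with operators on `S`. -/
inductive BlockCircuit (V : Op (D ⊕ A)) (S : Finset D) : ℕ → ℕ → Op (D ⊕ A) → Prop
  | one : BlockCircuit V S 0 0 1
  | psc {ρ β : ℕ} {G : Op (D ⊕ A)} (a : A) (h : BlockCircuit V S ρ β G) :
      BlockCircuit V S (ρ + 1) β (controlled (.inr a) V * G)
  | stab {ρ β : ℕ} {G : Op (D ⊕ A)} (a : A) (R : Op (D ⊕ A))
      (hR : IsInvolutionOn (S.map Function.Embedding.inl) R) (h : BlockCircuit V S ρ β G) :
      BlockCircuit V S ρ (β + 1) (controlled (.inr a) R * G)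
  | other {ρ β : ℕ} {G : Op (D ⊕ A)} (g : Op (D ⊕ A)) (hg : BlockDiag g) (hgV : Commute g V)
      (hgS : ∀ W, IsPauliOn (S.map Function.Embedding.inl) W → Commute g W)
      (h : BlockCircuit V S ρ β G) : BlockCircuit V S ρ β (g * G)

/-- The error `W` before the circuit `G` is a product of at most `N` gates after it. -/
def Propagates (N : ℕ) (G W : Op (D ⊕ A)) : Prop := ∃ E, Gen N E ∧ G * W = E * G

theorem Propagates.mul {N N' : ℕ} {G W W' : Op (D ⊕ A)} (h : Propagates N G W)
    (h' : Propagates N' G W') : Propagates (N + N') G (W * W') := by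
  obtain ⟨E, h1, h2⟩ := h
  obtain ⟨E', h1', h2'⟩ := h'
  exact ⟨E * E', h1.mul h1', by rw [← mul_assoc, h2, mul_assoc, h2', mul_assoc]⟩

theorem Propagates.mono {N N' : ℕ} (hN : N ≤ N') {G W : Op (D ⊕ A)} (h : Propagates N G W) :
    Propagates N' G W := by
  obtain ⟨E, h1, h2⟩ := h; exact ⟨E, h1.mono hN, h2⟩

variable [Nonempty D]

theorem card_map_inl {S : Finset D} {n : ℕ} (hn : S.card ≤ n) :
    (S.map (Function.Embedding.inl : D ↪ D ⊕ A)).card ≤ n := by rwa [Finset.card_map]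

theorem gen_controlled_of_data {S : Finset D} {n : ℕ} (hn : S.card ≤ n) (a : A) {W : Op (D ⊕ A)}
    (hW : IsPauliOn (S.map Function.Embedding.inl) W) :
    Gen (ctlCost n) (controlled (.inr a) W) :=
  gen_controlled (card_map_inl hn) (by simp) hW

/-- Invariant: `Y` is a product of at most `ρ` operators `C(K)`, with the fixed `K = P V P Vᴴ`, and
of ancilla-diagonal operators. So it passes any further gate at the price of at most `ρ` CZs. A gate
`C(V)` adds one `C(K)`, a controlled Pauli adds at most one `Z` on its ancilla, and both add the CZs
from passing `Y`. -/
theorem BlockCircuit.exists_of_pauli {S : Finset D} {n : ℕ} (hn : S.card ≤ n) {V : Op (D ⊕ A)}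
    (hV : IsRootOn S V) {P : Op (D ⊕ A)}
    (hP : IsInvolutionOn (S.map Function.Embedding.inl) P) {ρ β : ℕ} {G : Op (D ⊕ A)}
    (hG : BlockCircuit V S ρ β G) :
    ∃ Y, G * P = P * Y * G ∧ BlockDiag Y ∧
      Gen (ρ * (ctlCost n + 22 * ρ) + β * (22 * ρ + 22)) Y ∧
      (∀ a, Twist (controlled (.inr a) V) (22 * ρ) Y) ∧
      (∀ a R, IsInvolutionOn (S.map Function.Embedding.inl) R →
        Twist (controlled (.inr a) R) (22 * ρ) Y) ∧
      ∀ g, BlockDiag g → Commute g V →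
        (∀ W, IsPauliOn (S.map Function.Embedding.inl) W → Commute g W) → Commute g Y := by
  set K : Op (D ⊕ A) := P * (V * P * Vᴴ) with hK
  have hKon : IsPauliOn (S.map Function.Embedding.inl) K :=
    hP.1.mul (hV.clifford.isPauliOn_conj hV.fixes hP.1)
  have hVP : V * P = P * K * V := by
    rw [hK, ← mul_assoc, hP.2, one_mul, mul_assoc _ Vᴴ, hV.clifford.conjTranspose_mul, mul_one]
  obtain ⟨ε, hε, hVK⟩ := hKon.isPauli.exists_sign_of_mul_mul (hV.mul_mul_eq hP.2)
  induction hG with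
  | one =>
    refine ⟨1, by simp, blockDiag_one, gen_one.mono (by omega),
      fun a => ancDiag_one.twist (hV.blockDiag.controlled a),
      fun a R hR => ancDiag_one.twist (hR.1.blockDiag.controlled a), fun g _ _ _ =>
      Commute.one_right g⟩
  | @psc ρ β G a _ ih =>
    obtain ⟨Y, h1, h2, h3, h4, h5, h6⟩ := ih
    obtain ⟨E, hE, hEgen, hEY⟩ := h4 a
    refine ⟨controlled (.inr a) K * (Y * E), ?_,
      (hKon.blockDiag.controlled a).mul (h2.mul hE.blockDiag), ?_, fun c => ?_, fun c R hR => ?_,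
      fun g hg hgV hgS => ?_⟩
    · have h7 := controlled_mul_eq (hP.1.blockDiag.proj a) (hKon.blockDiag.proj a) hVP
      calc controlled (.inr a) V * G * P
          = controlled (.inr a) V * P * Y * G := by
            rw [mul_assoc, h1]; simp only [mul_assoc]
        _ = P * controlled (.inr a) K * (controlled (.inr a) V * Y) * G := by
            rw [h7]; simp only [mul_assoc]
        _ = _ := by rw [hEY]; simp only [mul_assoc]
    · refine ((gen_controlled_of_data hn a hKon).mul (h3.mul hEgen)).mono ?_
      nlinarith
    · exact ((twist_controlled hV.blockDiag hKon.blockDiag hε hVK).mul ((h4 c).mul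
        (hE.twist (hV.blockDiag.controlled c)) hE.blockDiag) (h2.mul hE.blockDiag)).mono
        (by omega)
    · obtain ⟨ε', hε', hRK⟩ := hR.1.isPauli.exists_sign hKon.isPauli
      exact ((twist_controlled hR.1.blockDiag hKon.blockDiag hε' hRK).mul ((h5 c R hR).mul
        (hE.twist (hR.1.blockDiag.controlled c)) hE.blockDiag) (h2.mul hE.blockDiag)).mono
        (by omega)
    · exact (commute_controlled (hg.proj a).symm (hgS K hKon)).mul_right
        ((h6 g hg hgV hgS).mul_right (hg E hE).symm)
  | @stab ρ β G a R hR _ ih =>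
    obtain ⟨Y, h1, h2, h3, h4, h5, h6⟩ := ih
    obtain ⟨E, hE, hEgen, hEY⟩ := h5 a R hR
    obtain ⟨ε', hε', hRP⟩ := hR.1.isPauli.exists_sign hP.1.isPauli
    set E' : Op (D ⊕ A) := controlled (.inr a) (controlled (.inr a) (ε' • 1)) with hE'
    -- Controlling twice on the same ancilla changes nothing, so the sign from passing `P` is
    -- covered by the bound for doubly controlled signs.
    have hsq : controlled (.inr a : D ⊕ A) (ε' • 1) = E' := by
      have h0 := proj_mul_self (.inr a : D ⊕ A) true
      have h01 : proj (.inr a : D ⊕ A) true * proj (.inr a) false = 0 := by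
        rw [proj_false_eq, mul_sub, h0, mul_one, sub_self]
      simp only [hE', controlled, mul_add, ← mul_assoc, h0, h01, zero_add]
    have hE'd : AncDiag E' := ((ancDiag_smul_one ε').controlled a).controlled a
    have hE'g : Gen 22 E' := gen_controlled_controlled_sign _ _ hε'
    refine ⟨Y * (E' * E), ?_, h2.mul (hE'd.mul hE).blockDiag, ?_, fun c => ?_, fun c R' hR' => ?_,
      fun g hg hgV hgS => ?_⟩
    · have h7 : controlled (.inr a) R * P = P * E' * controlled (.inr a) R := by
        rw [← hsq]
        exact controlled_mul_eq (hP.1.blockDiag.proj a) ((Commute.one_right _).smul_right _)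
          (by simp [hRP])
      calc controlled (.inr a) R * G * P
          = controlled (.inr a) R * P * Y * G := by
            rw [mul_assoc, h1]; simp only [mul_assoc]
        _ = P * E' * (controlled (.inr a) R * Y) * G := by
            rw [h7]; simp only [mul_assoc]
        _ = P * (E' * Y) * E * controlled (.inr a) R * G := by rw [hEY]; simp only [mul_assoc]
        _ = _ := by rw [(h2 E' hE'd).eq]; simp only [mul_assoc]
    · refine (h3.mul (hE'g.mul hEgen)).mono ?_
      nlinarith
    · exact (h4 c).mul ((hE'd.mul hE).twist (hV.blockDiag.controlled c))
        (hE'd.mul hE).blockDiag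
    · exact (h5 c R' hR').mul ((hE'd.mul hE).twist (hR'.1.blockDiag.controlled c))
        (hE'd.mul hE).blockDiag
    · exact (h6 g hg hgV hgS).mul_right (hg _ (hE'd.mul hE)).symm
  | other g hg hgV hgS _ ih =>
    obtain ⟨Y, h1, h2, h3, h4, h5, h6⟩ := ih
    refine ⟨Y, ?_, h2, h3, h4, h5, h6⟩
    rw [mul_assoc, h1, ← mul_assoc, ← mul_assoc, (hgS P hP.1).eq, mul_assoc P g,
      (h6 g hg hgV hgS).eq]
    simp only [mul_assoc]

/-- A controlled Pauli `C(R)` turns `F` into `C(R') * F * C(R)` with `R' = V R Vᴴ`, while `C(V)`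
only adds CZs. The cost of passing `C(R)` is deliberately left unbounded: collecting factors `C(R'
R)` on one side would create CZs for pairs of controlled Paulis, a count quadratic in `β` and hence
in `wq`. The two-sided form costs only two controlled Paulis. -/
theorem BlockCircuit.exists_of_root {S : Finset D} {n : ℕ} (hn : S.card ≤ n) {V : Op (D ⊕ A)}
    (hV : IsRootOn S V) {ρ β : ℕ} {G : Op (D ⊕ A)} (hG : BlockCircuit V S ρ β G) :
    ∃ F, G * V = V * F * G ∧ BlockDiag F ∧
      Gen (β * (2 * ctlCost n) + ρ * (22 * β)) F ∧
      (∀ a, Twist (controlled (.inr a) V) (22 * β) F) ∧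
      (∀ a R, IsInvolutionOn (S.map Function.Embedding.inl) R →
        ∃ N, Twist (controlled (.inr a) R) N F) ∧
      ∀ g, BlockDiag g → Commute g V →
        (∀ W, IsPauliOn (S.map Function.Embedding.inl) W → Commute g W) → Commute g F := by
  induction hG with
  | one =>
    refine ⟨1, by simp, blockDiag_one, gen_one.mono (by omega),
      fun a => ancDiag_one.twist (hV.blockDiag.controlled a),
      fun a R hR => ⟨0, ancDiag_one.twist (hR.1.blockDiag.controlled a)⟩, fun g _ _ _ =>
      Commute.one_right g⟩
  | @psc ρ β G a _ ih =>
    obtain ⟨F, h1, h2, h3, h4, h5, h6⟩ := ih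
    obtain ⟨E, hE, hEgen, hEF⟩ := h4 a
    refine ⟨F * E, ?_, h2.mul hE.blockDiag, ?_, fun c => ?_, fun c R hR => ?_,
      fun g hg hgV hgS => ?_⟩
    · have h7 : Commute (controlled (.inr a) V) V :=
        (commute_controlled (hV.blockDiag.proj a).symm (Commute.refl V)).symm
      calc controlled (.inr a) V * G * V
          = controlled (.inr a) V * V * F * G := by
            rw [mul_assoc, h1]; simp only [mul_assoc]
        _ = V * (controlled (.inr a) V * F) * G := by rw [h7.eq]; simp only [mul_assoc]
        _ = _ := by rw [hEF]; simp only [mul_assoc]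
    · exact (h3.mul hEgen).mono (by nlinarith)
    · exact (h4 c).mul (hE.twist (hV.blockDiag.controlled c)) hE.blockDiag
    · obtain ⟨N, hN⟩ := h5 c R hR
      exact ⟨_, hN.mul (hE.twist (hR.1.blockDiag.controlled c)) hE.blockDiag⟩
    · exact (h6 g hg hgV hgS).mul_right (hg E hE).symm
  | @stab ρ β G a R hR _ ih =>
    obtain ⟨F, h1, h2, h3, h4, h5, h6⟩ := ih
    set R' : Op (D ⊕ A) := V * R * Vᴴ with hR'
    have hR'on : IsPauliOn (S.map Function.Embedding.inl) R' :=
      hV.clifford.isPauliOn_conj hV.fixes hR.1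
    have hR'i : IsInvolutionOn (S.map Function.Embedding.inl) R' := by
      refine ⟨hR'on, ?_⟩
      calc R' * R' = V * R * (Vᴴ * V) * R * Vᴴ := by simp only [hR', mul_assoc]
        _ = V * (R * R) * Vᴴ := by
          rw [hV.clifford.conjTranspose_mul, mul_one]; simp only [mul_assoc]
        _ = 1 := by rw [hR.2, mul_one, hV.clifford.mul_conjTranspose]
    obtain ⟨N, E, hE, -, hEF⟩ := h5 a R' hR'i
    have hKon : IsPauliOn (S.map Function.Embedding.inl) (R' * R) := hR'on.mul hR.1
    obtain ⟨ε, hε, hVK⟩ := hKon.isPauli.exists_sign_of_mul_mul (hV.mul_mul_eq' hR.2)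
    have hgg : controlled (.inr a) R * controlled (.inr a) R = 1 := by
      rw [controlled_mul (hR.1.blockDiag.proj a), hR.2, controlled_one]
    have hgR := hR.1.blockDiag.controlled a
    -- The left side serves the gate count. The right side serves commutation: past `C(V)`, the
    -- factor `C(R' R)` costs one CZ and `E` nothing.
    have hF : controlled (.inr a) R' * F * controlled (.inr a) R =
        F * (controlled (.inr a) (R' * R) * E) := by
      rw [hEF, ← controlled_mul (hR'on.blockDiag.proj a), mul_assoc F, (((hR'on.blockDiag.controlled
        a)) E hE).eq, mul_assoc, mul_assoc, (hgR E hE).eq, mul_assoc]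
    have hFb : BlockDiag (controlled (.inr a) (R' * R) * E) :=
      (hKon.blockDiag.controlled a).mul hE.blockDiag
    refine ⟨controlled (.inr a) R' * F * controlled (.inr a) R, ?_,
      ((hR'on.blockDiag.controlled a).mul h2).mul hgR, ?_, fun c => ?_, fun c R₂ hR₂ => ?_,
      fun g hg hgV hgS => ?_⟩
    · have h7 : controlled (.inr a) R * V = V * controlled (.inr a) R' :=
        (mul_controlled (hV.blockDiag.proj a).symm hV.mul_conj.symm).symm
      calc controlled (.inr a) R * G * V
          = controlled (.inr a) R * V * F * G := by
            rw [mul_assoc, h1]; simp only [mul_assoc]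
        _ = V * (controlled (.inr a) R' * F) *
              (controlled (.inr a) R * controlled (.inr a) R) * G := by
            rw [h7, hgg]; simp only [mul_assoc, mul_one]
        _ = _ := by simp only [mul_assoc]
    · exact (((gen_controlled_of_data hn a hR'on).mul h3).mul
        (gen_controlled_of_data hn a hR.1)).mono (by nlinarith)
    · rw [hF]
      exact ((h4 c).mul ((twist_controlled hV.blockDiag hKon.blockDiag hε hVK).mul
        (hE.twist (hV.blockDiag.controlled c)) hE.blockDiag) hFb).mono (by omega)
    · rw [hF]
      obtain ⟨N, hN⟩ := h5 c R₂ hR₂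
      obtain ⟨ε', hε', hRK⟩ := hR₂.1.isPauli.exists_sign hKon.isPauli
      exact ⟨_, hN.mul ((twist_controlled hR₂.1.blockDiag hKon.blockDiag hε' hRK).mul
        (hE.twist (hR₂.1.blockDiag.controlled c)) hE.blockDiag) hFb⟩
    · exact ((commute_controlled (hg.proj a).symm (hgS R' hR'on)).mul_right
        (h6 g hg hgV hgS)).mul_right (commute_controlled (hg.proj a).symm (hgS R hR.1))
  | other g hg hgV hgS _ ih =>
    obtain ⟨F, h1, h2, h3, h4, h5, h6⟩ := ih
    refine ⟨F, ?_, h2, h3, h4, h5, h6⟩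
    rw [mul_assoc, h1, ← mul_assoc, ← mul_assoc, hgV.eq, mul_assoc V g, (h6 g hg hgV hgS).eq]
    simp only [mul_assoc]

/-- Propagation of Pauli errors on the data qubits. -/
theorem BlockCircuit.propagates_pauli {S : Finset D} (hS : S.Nonempty) {n : ℕ} (hn : S.card ≤ n)
    {V : Op (D ⊕ A)} (hV : IsRootOn S V) {P : Op (D ⊕ A)}
    (hP : IsInvolutionOn (S.map Function.Embedding.inl) P) {ρ β : ℕ} {G : Op (D ⊕ A)}
    (hG : BlockCircuit V S ρ β G) :
    Propagates (4 * n + 3 + (ρ * (ctlCost n + 22 * ρ) + β * (22 * ρ + 22))) G P := by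
  obtain ⟨Y, h1, -, h3, -⟩ := hG.exists_of_pauli hn hV hP
  exact ⟨P * Y, (gen_pauli (by simpa using hS) (card_map_inl hn) hP.1).mul h3, h1⟩

/-- Propagation of errors `V`. -/
theorem BlockCircuit.propagates_root {S : Finset D} {n : ℕ} (hn : S.card ≤ n)
    {V : Op (D ⊕ A)} (hV : IsRootOn S V) {ρ β : ℕ} {G : Op (D ⊕ A)}
    (hG : BlockCircuit V S ρ β G) :
    Propagates (4 * (2 * n + 1) * n + 1 + (β * (2 * ctlCost n) + ρ * (22 * β))) G V := by
  obtain ⟨F, h1, -, h3, -⟩ := hG.exists_of_root hn hV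
  refine ⟨V * F, Gen.mul ?_ h3, h1⟩
  exact (hV.clifford.gen (card_map_inl hn) hV.fixes).mono (by
    have := card_map_inl (A := A) hn
    gcongr)

/-! ### Errors on the ancillas -/

/-- The operator of the circuit with the gates `C(U)` for `(a, U)` in a list. -/
noncomputable def controlledCircuit (l : List (A × Op (D ⊕ A))) : Op (D ⊕ A) :=
  (l.map fun g => controlled (.inr g.1) g.2).reverse.prod

theorem controlledCircuit_cons (g : A × Op (D ⊕ A)) (l : List (A × Op (D ⊕ A))) :
    controlledCircuit (g :: l) = controlledCircuit l * controlled (.inr g.1) g.2 := by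
  simp [controlledCircuit]

theorem controlledCircuit_blockDiag {l : List (A × Op (D ⊕ A))}
    (hl : ∀ g ∈ l, BlockDiag g.2) : BlockDiag (controlledCircuit l) := by
  induction l with
  | nil => exact blockDiag_one
  | cons g l ih =>
    rw [controlledCircuit_cons]
    exact (ih fun g hg => hl g (by simp [hg])).mul ((hl g (by simp)).controlled _)

/-- Errors on the ancillas that commute with the circuit. -/
theorem propagates_of_ancDiag {E : Op (D ⊕ A)} (hE : AncDiag E) {N : ℕ} (hN : Gen N E)
    {G : Op (D ⊕ A)} (hG : BlockDiag G) : Propagates N G E :=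
  ⟨E, hN, (hG E hE).eq.symm⟩

/-- Propagation of `X` errors on an ancilla. -/
theorem propagates_X (a : A) (N : ℕ) (l : List (A × Op (D ⊕ A)))
    (hblock : ∀ g ∈ l, BlockDiag g.2)
    (hX : ∀ g ∈ l, Commute g.2 (pauliOp (single (.inr a) .X)))
    (hsq : ∀ g ∈ l, ∃ b : ℕ, g.2 * g.2 = Complex.I ^ b • 1)
    (hN : ∀ g l', g :: l' <:+ l → g.1 = a → Propagates N (controlledCircuit l') g.2) :
    Propagates (7 + l.countP (fun g => g.1 = a) * (N + 22)) (controlledCircuit l)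
      (pauliOp (single (.inr a) .X)) := by
  set X : Op (D ⊕ A) := pauliOp (single (.inr a) .X) with hXdef
  induction l with
  | nil =>
    refine ⟨X, ?_, by simp [controlledCircuit]⟩
    exact gen_pauli (n := 1) (S := {.inr a}) (by simp) (by simp)
      (isPauliOn_single (by simp) _) |>.mono (by omega)
  | cons g l ih =>
    have hl : ∀ g' ∈ l, g' ∈ g :: l := fun g' hg' => by simp [hg']
    have ih := ih (fun g' hg' => hblock g' (hl g' hg')) (fun g' hg' => hsq g' (hl g' hg'))
      (fun g' l' h => hN g' l' (h.trans (List.suffix_cons g l)))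
      (fun g' hg' => hX g' (hl g' hg'))
    have hgl : g ∈ g :: l := by simp
    rw [controlledCircuit_cons]
    by_cases hga : g.1 = a
    · rw [List.countP_cons_of_pos (by simpa using hga)]
      obtain ⟨b, hb⟩ := hsq g hgl
      -- Passing a gate controlled by `a`, the error `X` survives and sheds the target `g.2`,
      -- charged `N` for the rest of the circuit, and a phase on the ancilla, charged 22. The
      -- surviving `X` costs 7 at the end.
      have h1 := controlled_mul_X ((hblock g hgl).proj a) (hX g hgl) (I_pow_mul_conj b) hb
      have h2 : AncDiag (controlled (.inr a) (star (Complex.I ^ b) • (1 : Op (D ⊕ A)))) :=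
        (ancDiag_smul_one _).controlled a
      have h3 : star (Complex.I ^ b) = Complex.I ^ (3 * b) := by
        rw [star_pow, pow_mul, Complex.I_pow_three]; simp
      have h4 : Gen 22 (controlled (.inr a) (star (Complex.I ^ b) • (1 : Op (D ⊕ A)))) := by
        rw [h3]
        exact gen_controlled (n := 1) (S := ∅) (by simp) (by simp) ((isPauliOn_one ∅).smul _)
      obtain ⟨E, hE, hGE⟩ := ((hN g l List.suffix_rfl hga).mul ih).mul
        (propagates_of_ancDiag h2 h4
          (controlledCircuit_blockDiag fun g' hg' => hblock g' (hl g' hg')))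
      refine ⟨E, hE.mono (by ring_nf; omega), ?_⟩
      rw [hga, mul_assoc, h1, ← mul_assoc, hGE, mul_assoc]
    · rw [List.countP_cons_of_neg (by simpa using hga)]
      obtain ⟨E, hE, hGE⟩ := ih
      refine ⟨E, hE, ?_⟩
      have h1 : Commute X (proj (.inr g.1) true) := by
        rw [proj_true]
        refine ((Commute.one_right X).sub_right ?_).smul_right _
        refine pauliOp_commute_of_disjoint fun q => ?_
        by_cases h : q = .inr a
        · right; rw [h]; exact single_of_ne (by simpa using Ne.symm hga) _
        · left; exact single_of_ne h _
      rw [mul_assoc, ← (commute_controlled h1 (hX g hgl).symm).eq, ← mul_assoc, hGE, mul_assoc]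

end Propagation

/-! ### From single errors to error configurations -/

section Noise

variable {D A : Type*} [Fintype D] [DecidableEq D] [Fintype A] [DecidableEq A]

theorem propagates_one (G : Op (D ⊕ A)) : Propagates 0 G 1 := ⟨1, gen_one, by simp⟩

theorem propagates_smul_one [Nonempty D] (G : Op (D ⊕ A)) {u : ℂ} (hu : u * star u = 1) :
    Propagates 1 G (u • 1) := ⟨u • 1, gen_smul_one hu, by simp⟩

theorem propagates_pauliOp {G : Op (D ⊕ A)} {c : ℕ}
    (hc : ∀ q p, Propagates c G (pauliOp (single q p))) {S : Finset (D ⊕ A)}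
    {P : PauliString (D ⊕ A)} (hP : ∀ q ∉ S, P q = .I) :
    Propagates (S.card * c) G (pauliOp P) := by
  induction S using Finset.induction_on generalizing P with
  | empty =>
    have : P = fun _ => .I := funext fun q => hP q (by simp)
    rw [this, pauliOp_one]
    exact (propagates_one G).mono (by omega)
  | insert q S hq ih =>
    rw [← pauliOp_single_mul_update P q, Finset.card_insert_of_notMem hq]
    refine ((hc q _).mul (ih fun q' hq' => ?_)).mono (by rw [add_mul]; omega)
    by_cases h : q' = q
    · subst h; simp
    · simp only [Function.update_of_ne h]
      exact hP q' (by simp [h, hq'])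

theorem propagates_list {ι : Type*} {G : Op (D ⊕ A)} {c : ℕ} {W : ι → Op (D ⊕ A)} {l : List ι}
    (h : ∀ i ∈ l, Propagates c G (W i)) :
    Propagates (l.length * c) G (l.map W).reverse.prod := by
  induction l with
  | nil => simpa using propagates_one G
  | cons i l ih =>
    simp only [List.map_cons, List.reverse_cons, List.prod_append, List.prod_cons, List.prod_nil,
      mul_one, List.length_cons]
    exact ((ih fun j hj => h j (by simp [hj])).mul (h i (by simp))).mono (by rw [add_mul]; omega)

theorem idealOp_cons (g : Gate (D ⊕ A)) (gs : List (Gate (D ⊕ A))) :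
    idealOp (g :: gs) = idealOp gs * g.op := by
  simp [idealOp]

theorem countP_le_eq_add {ι : Type*} (l : List ι) (f : ι → ℕ) (t : ℕ) :
    l.countP (fun i => t ≤ f i) = l.countP (fun i => f i = t) + l.countP (fun i => t + 1 ≤ f i) := by
  induction l with
  | nil => simp
  | cons i l ih =>
    simp only [List.countP_cons, ih, decide_eq_true_eq]
    split_ifs <;> omega

/-- If every single error propagates to at most `c` gates, the noisy circuit differs from the
ideal one by at most `c` gates for every error location. -/
theorem exists_noisyFrom {M : ℕ} {loc : Fin M → ErrorLocation (D ⊕ A)}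
    {E : Fin M → PauliString (D ⊕ A)} {c : ℕ} (gs : List (Gate (D ⊕ A))) (t : ℕ)
    (h : ∀ i d, Propagates c (idealOp (gs.drop d)) (pauliOp (E i))) :
    ∃ F, Gen ((List.finRange M).countP (fun i => t ≤ (loc i).time) * c) F ∧
      noisyFrom loc E t gs = F * idealOp gs := by
  have herr : Propagates ((List.finRange M).countP (fun i => (loc i).time = t) * c) (idealOp gs)
      (errorAt loc E t) := by
    rw [List.countP_eq_length_filter]
    exact propagates_list fun i _ => h i 0
  obtain ⟨F, hF, hGF⟩ := herr
  induction gs generalizing t F with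
  | nil =>
    refine ⟨F, hF.mono ?_, ?_⟩
    · rw [countP_le_eq_add, add_mul]; omega
    · simpa [idealOp, noisyFrom] using hGF
  | cons g gs ih =>
    have h' : ∀ i d, Propagates c (idealOp (gs.drop d)) (pauliOp (E i)) := fun i d => h i (d + 1)
    have herr : Propagates ((List.finRange M).countP (fun i => (loc i).time = t + 1) * c)
        (idealOp gs) (errorAt loc E (t + 1)) := by
      rw [List.countP_eq_length_filter]
      exact propagates_list fun i _ => h' i 0
    obtain ⟨F', hF', hGF'⟩ := herr
    obtain ⟨K, hK, hKG⟩ := ih (t + 1) h' F' hF' hGF'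
    -- `F` carries the errors of time `t` to the end past all of `g :: gs`; `K` carries the later
    -- ones.
    refine ⟨K * F, (hK.mul hF).mono ?_, ?_⟩
    · rw [countP_le_eq_add (List.finRange M) (fun i => (loc i).time) t, add_mul]; omega
    · rw [noisyFrom, hKG, mul_assoc K, ← idealOp_cons, mul_assoc, hGF, mul_assoc]

end Noise

/-! ### Squares and signs of products -/

section Squares

variable {Q : Type*} [Fintype Q] [DecidableEq Q]

theorem prod_pow_two_of_commute {ι : Type*} {v : ι → Op Q} (hv : ∀ i j, Commute (v i) (v j))
    (l : List ι) : (l.map v).prod ^ 2 = (l.map fun i => v i ^ 2).prod := by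
  induction l with
  | nil => simp
  | cons i l ih =>
    simp only [List.map_cons, List.prod_cons]
    rw [Commute.mul_pow, ih]
    refine Commute.list_prod_right _ _ fun x hx => ?_
    obtain ⟨j, -, rfl⟩ := List.mem_map.mp hx
    exact hv i j

theorem prod_anticommute {ι : Type*} {w : ι → Op Q} {K : Op Q} {i : ι} {l : List ι}
    (hl : l.Nodup) (hi : i ∈ l) (hK : w i * K = -(K * w i))
    (hj : ∀ j, j ≠ i → Commute (w j) K) : (l.map w).prod * K = -(K * (l.map w).prod) := by
  induction l with
  | nil => simp at hi
  | cons j l ih =>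
    rw [List.nodup_cons] at hl
    rw [List.map_cons, List.prod_cons, mul_assoc]
    by_cases h : j = i
    · subst h
      have h1 : Commute (l.map w).prod K := by
        refine Commute.list_prod_left _ _ fun x hx => ?_
        obtain ⟨j', hj', rfl⟩ := List.mem_map.mp hx
        exact hj j' (by rintro rfl; exact hl.1 hj')
      rw [h1.eq, ← mul_assoc, hK, neg_mul, mul_assoc]
    · have hil : i ∈ l := by
        rcases List.mem_cons.mp hi with h' | h'
        · exact absurd h'.symm h
        · exact h'
      rw [ih hl.2 hil, mul_neg, ← mul_assoc, (hj j h).eq, mul_assoc]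

end Squares

/-! ### The blocks of the transversal PSC -/

namespace StandardProtocol

variable {n m ℓ r : ℕ} (p : StandardProtocol n m ℓ r)

/-- The ancilla qubits of the protocol. -/
abbrev Anc : Type :=
  ({s : Fin r // p.isPSCRound s = false} × Fin m) ⊕ {s : Fin r // p.isPSCRound s = true}

/-- The tensor factor `V i` as an operator on all qubits. -/
noncomputable def root (i : Fin ℓ) : Op (Fin n ⊕ p.Anc) :=
  embed ((Function.Embedding.subtype fun q => q ∈ p.T i).trans Function.Embedding.inl) (p.V i)

/-- If the square of one factor anticommuted with a letter on its support, then so would the product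
of all squares, since the other squares live elsewhere; but that product is 1. So the square is a
Pauli commuting with all letters, that is, a power of `i`. -/
theorem exists_sq_eq (i : Fin ℓ) : ∃ b : ℕ, p.V i * p.V i = Complex.I ^ b • 1 := by
  set f : (i : Fin ℓ) → p.T i ↪ Fin n := fun i => Function.Embedding.subtype fun q => q ∈ p.T i
    with hf
  have hprod := p.sq_eq_one
  have hcomm : ∀ i j, Commute (embed (f i) (p.V i)) (embed (f j) (p.V j)) := by
    intro i j
    by_cases h : i = j
    · subst h; exact Commute.refl _
    · exact embed_commute _ _ (fun a b hab => Finset.disjoint_left.mp (p.disjoint_T i j h) a.2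
        (by rw [show (a : Fin n) = b from hab]; exact b.2)) _ _
  rw [prod_pow_two_of_commute hcomm] at hprod
  have hon : ∀ i, IsPauliOn (p.T i) (embed (f i) (p.V i) ^ 2) := by
    intro i
    rw [sq, ← embed_mul, ← sq]
    refine (isPauli_embed (f i) (p.isPSC_V i).2.2).mono fun q hq => ?_
    obtain ⟨a, -, rfl⟩ := Finset.mem_map.mp hq
    exact a.2
  have hcK : ∀ q l, Commute (embed (f i) (p.V i) ^ 2) (pauliOp (single q l)) := by
    intro q l
    by_cases hq : q ∈ p.T i
    · rcases (hon i).isPauli.comm (isPauliOn_single hq l).isPauli with h | h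
      · exact h
      · exfalso
        have h1 := prod_anticommute (w := fun i => embed (f i) (p.V i) ^ 2)
          (List.nodup_finRange ℓ) (List.mem_finRange i) h fun j hj =>
            commute_Z_of_notMem (Finset.disjoint_right.mp (p.disjoint_T j i hj) hq) (hon j) l
        rw [hprod, one_mul, mul_one] at h1
        refine pauliOp_ne_zero (single q l) ?_
        ext x y
        exact self_eq_neg.mp (congrFun (congrFun h1 x) y)
    · exact commute_Z_of_notMem hq (hon i) l
  obtain ⟨b, P, hP, hb⟩ := (hon i).isPauli.isPauliOn (S := ∅) fun q _ l => hcK q l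
  refine ⟨b, embed_injective (f i) ?_⟩
  rw [embed_mul, ← sq, hb, embed_smul, embed_one, ← pauliOp_one]
  congr 2; funext q; exact hP q (by simp)

theorem isRootOn_root (i : Fin ℓ) : IsRootOn (p.T i) (p.root i) where
  clifford := (p.isPSC_V i).1.embed _
  fixes := fun P hP => by
    refine (pauliOp_commute_embed _ P (fun a => hP _ ?_) _).symm
    exact Finset.mem_map_of_mem _ a.2
  blockDiag := blockDiag_embed _ _
  sq := by
    obtain ⟨b, hb⟩ := p.exists_sq_eq i
    exact ⟨b, by rw [root, ← embed_mul, hb, embed_smul, embed_one]⟩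

theorem root_commute_pauliOp (i : Fin ℓ) {P : PauliString (Fin n ⊕ p.Anc)}
    (hP : ∀ q ∈ p.T i, P (.inl q) = .I) : Commute (p.root i) (pauliOp P) :=
  (pauliOp_commute_embed _ P (fun a => hP _ a.2) _).symm

theorem root_commute_root {i j : Fin ℓ} (h : i ≠ j) : Commute (p.root i) (p.root j) :=
  embed_commute _ _ (fun a b hab => Finset.disjoint_left.mp (p.disjoint_T i j h) a.2
    (by rw [show (a : Fin n) = b from Sum.inl_injective hab]; exact b.2)) _ _

theorem root_commute_isPauliOn (i : Fin ℓ) {S : Finset (Fin n)} (hS : Disjoint S (p.T i))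
    {W : Op (Fin n ⊕ p.Anc)} (hW : IsPauliOn (S.map Function.Embedding.inl) W) :
    Commute (p.root i) W := by
  obtain ⟨a, P, hP, rfl⟩ := hW
  exact (p.root_commute_pauliOp i fun q hq =>
    hP _ (by simpa using Finset.disjoint_right.mp hS hq)).smul_right _

/-! ### Gate labels and counting -/

/-- The gates of the protocol: a letter of a stabilizer in a stabilizer round, or a tensor factor
in a PSC round. -/
abbrev Label : Type :=
  ({s : Fin r // p.isPSCRound s = false} × Fin m × Fin n) ⊕
    ({s : Fin r // p.isPSCRound s = true} × Fin ℓ)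

/-- The control and the target operator of a gate. -/
noncomputable def labelPair : p.Label → p.Anc × Op (Fin n ⊕ p.Anc)
  | .inl (s, i, j) => (.inl (s, i), pauliOp (single (.inl j) (p.g i j)))
  | .inr (s, i) => (.inr s, p.root i)

/-- The gate with a given label. -/
noncomputable def labelGate : p.Label → Gate (Fin n ⊕ p.Anc)
  | .inl (s, i, j) => p.stabGate s i j
  | .inr (s, i) => p.pscGate s i

theorem labelGate_op (x : p.Label) :
    (p.labelGate x).op = controlled (.inr (p.labelPair x).1) (p.labelPair x).2 := by
  rcases x with ⟨s, i, j⟩ | ⟨s, i⟩ <;> rfl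

/-- The labels of the gates of a round. -/
def roundLabels (s : Fin r) : List p.Label :=
  if h : p.isPSCRound s = true then
    (p.pscOrder s).map fun i => .inr (⟨s, h⟩, i)
  else
    (p.stabOrder s).map fun c => .inl (⟨s, Bool.eq_false_iff.mpr h⟩, c.1, c.2)

/-- The labels of all gates. -/
def labels : List p.Label := (List.finRange r).flatMap p.roundLabels

theorem gates_eq : p.gates = p.labels.map p.labelGate := by
  rw [gates, labels, List.map_flatMap]
  congr 1; funext s
  unfold roundGates roundLabels
  split_ifs <;> simp [List.map_map, Function.comp_def, labelGate]

theorem idealOp_eq (l : List p.Label) :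
    idealOp (l.map p.labelGate) = controlledCircuit (l.map p.labelPair) := by
  simp only [idealOp, controlledCircuit, List.map_map]
  congr 3; funext x; exact p.labelGate_op x

/-- The round of a gate. -/
def labelRound : p.Label → Fin r
  | .inl (s, _, _) => s
  | .inr (s, _) => s

theorem labelRound_of_mem {s : Fin r} {x : p.Label} (h : x ∈ p.roundLabels s) :
    p.labelRound x = s := by
  unfold roundLabels at h
  split_ifs at h <;> obtain ⟨c, -, rfl⟩ := List.mem_map.mp h <;> rfl

theorem nodup_labels : p.labels.Nodup := by
  refine List.nodup_flatMap.mpr ⟨fun s _ => ?_, ?_⟩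
  · unfold roundLabels
    split_ifs
    · refine (p.nodup_pscOrder s).map fun i j h => ?_
      simpa using h
    · refine (p.nodup_stabOrder s).map fun i j h => ?_
      simpa [Prod.ext_iff] using h
  · refine (List.nodup_finRange r).imp fun {s s'} hne x hx hx' => hne ?_
    rw [← p.labelRound_of_mem hx, p.labelRound_of_mem hx']

theorem g_ne_of_mem {s : {s : Fin r // p.isPSCRound s = false}} {i : Fin m} {j : Fin n}
    (h : Sum.inl (s, i, j) ∈ p.labels) : p.g i j ≠ .I := by
  obtain ⟨s', -, h⟩ := List.mem_flatMap.mp h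
  unfold roundLabels at h
  split_ifs at h
  · obtain ⟨c, -, hc⟩ := List.mem_map.mp h
    cases hc
  · obtain ⟨c, hc, hc'⟩ := List.mem_map.mp h
    simp only [Sum.inl.injEq, Prod.mk.injEq] at hc'
    obtain ⟨-, rfl, rfl⟩ := hc'
    exact (p.mem_stabOrder s' c).mp hc

/-- Labels record the round, so they do not repeat, and counting gates in any part of the circuit
reduces to bounding a finite set of labels. -/
theorem countP_le_card {l : List p.Label} (hl : l.Sublist p.labels) (P : p.Label → Bool)
    (F : Finset p.Label) (hF : ∀ x ∈ p.labels, P x = true → x ∈ F) : l.countP P ≤ F.card := by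
  rw [List.countP_eq_length_filter,
    ← List.toFinset_card_of_nodup ((p.nodup_labels.sublist hl).filter P)]
  refine Finset.card_le_card fun x hx => ?_
  simp only [List.mem_toFinset, List.mem_filter] at hx
  exact hF x (hl.subset hx.1) hx.2

/-- Whether a gate is a controlled Pauli gate on a data qubit in `S`. -/
def onData (S : Finset (Fin n)) : p.Label → Bool
  | .inl (_, _, j) => j ∈ S
  | .inr _ => false

/-- Whether a gate is a controlled tensor factor in `I`. -/
def onFactor (I : Finset (Fin ℓ)) : p.Label → Bool
  | .inl _ => false
  | .inr (_, i) => i ∈ I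

theorem card_round_le (b : Bool) :
    (Finset.univ : Finset {s : Fin r // p.isPSCRound s = b}).card ≤ r := by
  rw [Finset.card_univ]
  exact (Fintype.card_subtype_le _).trans (Fintype.card_fin r).le

theorem countP_onFactor_le {l : List p.Label} (hl : l.Sublist p.labels) (i : Fin ℓ) :
    l.countP (p.onFactor {i}) ≤ r := by
  refine (p.countP_le_card hl _ (Finset.univ.image fun s => .inr (s, i)) ?_).trans
    (Finset.card_image_le.trans (p.card_round_le true))
  rintro (⟨s, i', j⟩ | ⟨s, i'⟩) _ h
  · simp [onFactor] at h
  · simp only [onFactor, Finset.mem_singleton, decide_eq_true_eq] at h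
    subst h; simp

theorem countP_onData_le {l : List p.Label} (hl : l.Sublist p.labels) (S : Finset (Fin n)) :
    l.countP (p.onData S) ≤ S.card * (r * p.wq) := by
  refine (p.countP_le_card hl _ (S.biUnion fun j => Finset.univ.biUnion fun s =>
    (Finset.univ.filter fun i => p.g i j ≠ .I).image fun i => .inl (s, i, j)) ?_).trans ?_
  · rintro (⟨s, i, j⟩ | ⟨s, i⟩) hx h
    · simp only [onData, decide_eq_true_eq] at h
      simp only [Finset.mem_biUnion, Finset.mem_image, Finset.mem_filter, Finset.mem_univ, true_and]
      exact ⟨j, h, s, i, p.g_ne_of_mem hx, rfl⟩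
    · simp [onData] at h
  · refine Finset.card_biUnion_le_card_mul _ _ _ fun j _ => ?_
    refine (Finset.card_biUnion_le_card_mul _ _ p.wq fun s _ => ?_).trans
      (Nat.mul_le_mul_right _ (p.card_round_le false))
    exact Finset.card_image_le.trans (Finset.le_sup (f := fun j : Fin n =>
      (Finset.univ.filter fun i : Fin m => p.g i j ≠ Pauli.I).card) (Finset.mem_univ j))

theorem countP_control_le {l : List p.Label} (hl : l.Sublist p.labels) (a : p.Anc) :
    l.countP (fun x => (p.labelPair x).1 = a) ≤ p.wc + ℓ := by
  rcases a with ⟨s, i⟩ | s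
  · refine (p.countP_le_card hl _ ((Finset.univ.filter fun j => p.g i j ≠ .I).image
      fun j => .inl (s, i, j)) ?_).trans ?_
    · rintro (⟨s', i', j⟩ | ⟨s', i'⟩) hx h
      · simp only [labelPair, decide_eq_true_eq, Sum.inl.injEq, Prod.mk.injEq] at h
        obtain ⟨rfl, rfl⟩ := h
        simpa using p.g_ne_of_mem hx
      · simp [labelPair] at h
    · refine (Finset.card_image_le.trans (Finset.le_sup (f := fun i : Fin m =>
        (Finset.univ.filter fun j : Fin n => p.g i j ≠ Pauli.I).card) (Finset.mem_univ i))).trans ?_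
      exact Nat.le_add_right _ _
  · refine (p.countP_le_card hl _ (Finset.univ.image fun i => .inr (s, i)) ?_).trans ?_
    · rintro (⟨s', i', j⟩ | ⟨s', i'⟩) hx h
      · simp [labelPair] at h
      · simp only [labelPair, decide_eq_true_eq, Sum.inr.injEq] at h
        subst h; simp
    · refine Finset.card_image_le.trans ?_
      rw [Finset.card_univ, Fintype.card_fin]; omega

theorem controlledCircuit_concat {D A : Type*} [Fintype D] [DecidableEq D] [Fintype A]
    [DecidableEq A] (l : List (A × Op (D ⊕ A))) (g : A × Op (D ⊕ A)) :
    controlledCircuit (l ++ [g]) = controlled (.inr g.1) g.2 * controlledCircuit l := by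
  simp [controlledCircuit]

/-- Stated for a set `I` of factors so that one proof serves two cases: `V` the root of one factor,
and `V = 1` with `I` empty for data qubits outside all factors. -/
theorem blockCircuit_of_labels {V : Op (Fin n ⊕ p.Anc)} {S : Finset (Fin n)} (hV : IsRootOn S V)
    (I : Finset (Fin ℓ)) (hI : ∀ i ∈ I, p.root i = V)
    (hI' : ∀ i ∉ I, Commute (p.root i) V ∧ Disjoint S (p.T i)) (l : List p.Label) :
    BlockCircuit V S (l.countP (p.onFactor I)) (l.countP (p.onData S))
      (controlledCircuit (l.map p.labelPair)) := by
  -- `BlockCircuit` grows by later gates, which stand at the end of the list.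
  induction l using List.reverseRecOn with
  | nil => exact .one
  | append_singleton l x ih =>
    rw [List.map_append, List.map_singleton, controlledCircuit_concat, List.countP_append,
      List.countP_append, List.countP_singleton, List.countP_singleton]
    have hother : ∀ a U, BlockDiag U → Commute U V →
        (∀ W, IsPauliOn (S.map Function.Embedding.inl) W → Commute U W) →
        BlockCircuit V S (l.countP (p.onFactor I)) (l.countP (p.onData S))
          (controlled (.inr a) U * controlledCircuit (l.map p.labelPair)) := by
      intro a U hU hUV hUS
      refine .other _ (hU.controlled a) ?_ (fun W hW => ?_) ih
      · exact (commute_controlled (hV.blockDiag.proj a).symm hUV.symm).symm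
      · exact (commute_controlled (hW.blockDiag.proj a).symm (hUS W hW).symm).symm
    rcases x with ⟨s, i, j⟩ | ⟨s, i⟩
    · by_cases hj : j ∈ S
      · simp only [onFactor, onData, hj, decide_true, if_true, Bool.false_eq_true, if_false,
          add_zero]
        exact .stab _ _ ⟨isPauliOn_single (by simpa using hj) _, pauliOp_sq _⟩ ih
      · simp only [onFactor, onData, hj, decide_false, Bool.false_eq_true, if_false, add_zero]
        have hsingle : IsPauliOn (({j} : Finset (Fin n)).map Function.Embedding.inl)
            (pauliOp (single (.inl j : Fin n ⊕ p.Anc) (p.g i j))) :=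
          isPauliOn_single (by simp) _
        have hoff : ∀ q ∈ S.map Function.Embedding.inl,
            single (.inl j : Fin n ⊕ p.Anc) (p.g i j) q = .I := by
          intro q hq
          refine single_of_ne ?_ _
          rintro rfl
          simp [hj] at hq
        exact hother _ _ hsingle.blockDiag (hV.fixes _ hoff).symm
          fun W hW => (hW.fixes _ hoff).symm
    · by_cases hi : i ∈ I
      · simp only [onFactor, onData, hi, decide_true, if_true, Bool.false_eq_true, if_false,
          add_zero]
        have := BlockCircuit.psc (.inr s) ih
        rw [← hI i hi] at this ⊢
        exact this
      · simp only [onFactor, onData, hi, decide_false, Bool.false_eq_true, if_false, add_zero]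
        exact hother _ _ (p.isRootOn_root i).blockDiag (hI' i hi).1
          fun W hW => p.root_commute_isPauliOn i (hI' i hi).2 hW

theorem blockCircuit_root (i : Fin ℓ) (l : List p.Label) :
    BlockCircuit (p.root i) (p.T i) (l.countP (p.onFactor {i})) (l.countP (p.onData (p.T i)))
      (controlledCircuit (l.map p.labelPair)) := by
  refine p.blockCircuit_of_labels (p.isRootOn_root i) {i} (by simp) (fun j hj => ?_) l
  have hij : j ≠ i := by simpa using hj
  exact ⟨p.root_commute_root hij, (p.disjoint_T j i hij).symm⟩

theorem isRootOn_one (S : Finset (Fin n)) : IsRootOn S (1 : Op (Fin n ⊕ p.Anc)) :=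
  ⟨isClifford_one, fun _ _ => Commute.one_left _, blockDiag_one, 0, by simp⟩

theorem blockCircuit_one {j : Fin n} (hj : ∀ i, j ∉ p.T i) (l : List p.Label) :
    BlockCircuit 1 {j} (l.countP (p.onFactor ∅)) (l.countP (p.onData {j}))
      (controlledCircuit (l.map p.labelPair)) :=
  p.blockCircuit_of_labels (p.isRootOn_one _) ∅ (by simp)
    (fun i _ => ⟨Commute.one_right _, by simpa using hj i⟩) l

/-! ### Cost bounds and single-qubit errors -/

/-- The cost of an error on the data qubits, relative to `r ^ 2 * wq`. -/
def dataCost (k : ℕ) : ℕ :=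
  4 * (2 * k + 1) * k + 4 * k + 4 + 2 * k * ctlCost k + ctlCost k + 22 + 44 * k

theorem pauli_cost_le {k r wq ρ β : ℕ} (hr : 1 ≤ r) (hq : 1 ≤ wq) (hρ : ρ ≤ r)
    (hβ : β ≤ k * (r * wq)) :
    4 * k + 3 + (ρ * (ctlCost k + 22 * ρ) + β * (22 * ρ + 22)) ≤ dataCost k * (r ^ 2 * wq) := by
  have hr2 : r ≤ r ^ 2 := Nat.le_self_pow (by norm_num) r
  have hB : 1 ≤ r ^ 2 * wq := Nat.mul_pos (by positivity) hq
  have hrB : r ^ 2 ≤ r ^ 2 * wq := Nat.le_mul_of_pos_right _ hq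
  have h1 : ρ * (ctlCost k + 22 * ρ) ≤ (ctlCost k + 22) * (r ^ 2 * wq) := by
    calc ρ * (ctlCost k + 22 * ρ) ≤ r * (ctlCost k * r + 22 * r) := by
          gcongr
          exact Nat.le_mul_of_pos_right _ hr
      _ = (ctlCost k + 22) * r ^ 2 := by ring
      _ ≤ _ := by gcongr
  have h2 : β * (22 * ρ + 22) ≤ 44 * k * (r ^ 2 * wq) := by
    calc β * (22 * ρ + 22) ≤ k * (r * wq) * (22 * r + 22 * r) := by
          gcongr; omega
      _ = _ := by ring
  have h3 : 4 * k + 3 ≤ (4 * k + 3) * (r ^ 2 * wq) := Nat.le_mul_of_pos_right _ hB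
  calc _ ≤ (4 * k + 3) * (r ^ 2 * wq) + ((ctlCost k + 22) * (r ^ 2 * wq) +
        44 * k * (r ^ 2 * wq)) := by omega
    _ = (4 * k + 3 + ctlCost k + 22 + 44 * k) * (r ^ 2 * wq) := by ring
    _ ≤ _ := by
      refine Nat.mul_le_mul_right _ ?_
      unfold dataCost
      generalize 2 * k * ctlCost k = x
      generalize 4 * (2 * k + 1) * k = y
      omega

theorem root_cost_le {k r wq ρ β : ℕ} (hr : 1 ≤ r) (hq : 1 ≤ wq) (hρ : ρ ≤ r)
    (hβ : β ≤ k * (r * wq)) :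
    4 * (2 * k + 1) * k + 1 + (β * (2 * ctlCost k) + ρ * (22 * β)) ≤
      dataCost k * (r ^ 2 * wq) := by
  have hr2 : r ≤ r ^ 2 := Nat.le_self_pow (by norm_num) r
  have hB : 1 ≤ r ^ 2 * wq := Nat.mul_pos (by positivity) hq
  have h1 : β * (2 * ctlCost k) ≤ 2 * k * ctlCost k * (r ^ 2 * wq) := by
    calc β * (2 * ctlCost k) ≤ k * (r ^ 2 * wq) * (2 * ctlCost k) := by
          gcongr
          exact hβ.trans (by gcongr)
      _ = _ := by ring
  have h2 : ρ * (22 * β) ≤ 22 * k * (r ^ 2 * wq) := by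
    calc ρ * (22 * β) ≤ r * (22 * (k * (r * wq))) := by gcongr
      _ = _ := by ring
  have h3 : 4 * (2 * k + 1) * k + 1 ≤ (4 * (2 * k + 1) * k + 1) * (r ^ 2 * wq) :=
    Nat.le_mul_of_pos_right _ hB
  calc _ ≤ (4 * (2 * k + 1) * k + 1) * (r ^ 2 * wq) + (2 * k * ctlCost k * (r ^ 2 * wq) +
        22 * k * (r ^ 2 * wq)) := by omega
    _ = (4 * (2 * k + 1) * k + 1 + 2 * k * ctlCost k + 22 * k) * (r ^ 2 * wq) := by ring
    _ ≤ _ := by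
      refine Nat.mul_le_mul_right _ ?_
      unfold dataCost
      generalize 2 * k * ctlCost k = x
      generalize 4 * (2 * k + 1) * k = y
      omega

variable {k : ℕ} (hk : ∀ i, (p.T i).card ≤ k) (hr : 1 ≤ r) (hq : 1 ≤ p.wq) [Nonempty (Fin n)]
include hk hr hq

/-- A qubit of some `T i` is treated in that block, any other qubit as a block of its own with
trivial root. The parameter `k + 1` leaves room for the latter when `k = 0`. -/
theorem propagates_data {l : List p.Label} (hl : l.Sublist p.labels) (j : Fin n) (x : Pauli) :
    Propagates (dataCost (k + 1) * (r ^ 2 * p.wq)) (controlledCircuit (l.map p.labelPair))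
      (pauliOp (single (.inl j) x)) := by
  by_cases hj : ∃ i, j ∈ p.T i
  · obtain ⟨i, hi⟩ := hj
    have hc : (p.T i).card ≤ k + 1 := (hk i).trans (by omega)
    refine ((p.blockCircuit_root i l).propagates_pauli ⟨j, hi⟩ hc (p.isRootOn_root i)
      ⟨isPauliOn_single (by simpa using hi) x, pauliOp_sq _⟩).mono
      (pauli_cost_le hr hq (p.countP_onFactor_le hl i) ((p.countP_onData_le hl _).trans ?_))
    gcongr
  · push Not at hj
    refine ((p.blockCircuit_one hj l).propagates_pauli (n := k + 1) (by simp) (by simp)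
      (p.isRootOn_one _) ⟨isPauliOn_single (by simp) x, pauliOp_sq _⟩).mono
      (pauli_cost_le hr hq ?_ ((p.countP_onData_le hl _).trans ?_))
    · refine (p.countP_le_card hl _ ∅ ?_).trans (by simp)
      rintro (⟨s, i', j⟩ | ⟨s, i'⟩) _ h <;> simp [onFactor] at h
    · gcongr; simp

theorem propagates_root {l : List p.Label} (hl : l.Sublist p.labels) (i : Fin ℓ) :
    Propagates (dataCost (k + 1) * (r ^ 2 * p.wq)) (controlledCircuit (l.map p.labelPair))
      (p.root i) := by
  have hc : (p.T i).card ≤ k + 1 := (hk i).trans (by omega)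
  refine ((p.blockCircuit_root i l).propagates_root hc (p.isRootOn_root i)).mono
    (root_cost_le hr hq (p.countP_onFactor_le hl i) ((p.countP_onData_le hl _).trans ?_))
  gcongr

omit hk hr hq [Nonempty (Fin n)] in
theorem labelPair_blockDiag (x : p.Label) : BlockDiag (p.labelPair x).2 := by
  rcases x with ⟨s, i, j⟩ | ⟨s, i⟩
  · exact IsPauliOn.blockDiag (S := {j}) (isPauliOn_single (by simp) _)
  · exact (p.isRootOn_root i).blockDiag

theorem propagates_ancilla_X {l : List p.Label} (hl : l <:+ p.labels) (a : p.Anc) :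
    Propagates (7 + (p.wc + ℓ) * (dataCost (k + 1) * (r ^ 2 * p.wq) + 22))
      (controlledCircuit (l.map p.labelPair)) (pauliOp (single (.inr a) .X)) := by
  refine (propagates_X a (dataCost (k + 1) * (r ^ 2 * p.wq)) (l.map p.labelPair) ?_ ?_ ?_
    ?_).mono ?_
  · intro g hg
    obtain ⟨x, -, rfl⟩ := List.mem_map.mp hg
    exact p.labelPair_blockDiag x
  · intro g hg
    obtain ⟨x, -, rfl⟩ := List.mem_map.mp hg
    rcases x with ⟨s, i, j⟩ | ⟨s, i⟩
    · refine pauliOp_commute_of_disjoint fun q => ?_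
      rcases q with q | q
      · right; exact single_of_ne (by simp) _
      · left; exact single_of_ne (by simp) _
    · exact p.root_commute_pauliOp i fun q _ => single_of_ne (by simp) _
  · intro g hg
    obtain ⟨x, -, rfl⟩ := List.mem_map.mp hg
    rcases x with ⟨s, i, j⟩ | ⟨s, i⟩
    · exact ⟨0, by simp [labelPair, pauliOp_sq]⟩
    · exact (p.isRootOn_root i).sq
  · intro g l' h _
    -- The target shed at a gate meets the remaining part of the circuit as a Pauli data error or as
    -- a root.
    obtain ⟨l'', h1, h2⟩ := List.suffix_map_iff.mp h
    obtain ⟨x, l₀, rfl, rfl, rfl⟩ := List.map_eq_cons_iff.mp h2.symm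
    have hl₀ : l₀.Sublist p.labels := ((List.sublist_cons_self x l₀).trans h1.sublist).trans
      hl.sublist
    rcases x with ⟨s, i, j⟩ | ⟨s, i⟩
    · exact p.propagates_data hk hr hq hl₀ j _
    · exact p.propagates_root hk hr hq hl₀ i
  · rw [List.countP_map]
    gcongr
    exact p.countP_control_le hl.sublist a

/-- The cost of a single-qubit error, relative to `r ^ 2 * wq * (wc + ℓ)`. -/
def errorCost (k : ℕ) : ℕ := dataCost (k + 1) + 37

theorem propagates_single (hw : 1 ≤ p.wc + ℓ) {l : List p.Label} (hl : l <:+ p.labels)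
    (q : Fin n ⊕ p.Anc) (x : Pauli) :
    Propagates (errorCost k * (r ^ 2 * p.wq * (p.wc + ℓ)))
      (controlledCircuit (l.map p.labelPair)) (pauliOp (single q x)) := by
  have hB : 1 ≤ r ^ 2 * p.wq * (p.wc + ℓ) :=
    Nat.mul_pos (Nat.mul_pos (by positivity) hq) hw
  have hB' : p.wc + ℓ ≤ r ^ 2 * p.wq * (p.wc + ℓ) :=
    Nat.le_mul_of_pos_left _ (Nat.mul_pos (by positivity) hq)
  rcases q with j | a
  · refine (p.propagates_data hk hr hq hl.sublist j x).mono ?_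
    refine Nat.mul_le_mul (by unfold errorCost; omega) (Nat.le_mul_of_pos_right _ hw)
  · have hX := p.propagates_ancilla_X hk hr hq hl a
    have hZ : Propagates 7 (controlledCircuit (l.map p.labelPair))
        (pauliOp (single (.inr a) .Z)) := by
      refine propagates_of_ancDiag ?_ ?_ (controlledCircuit_blockDiag fun g hg => ?_)
      · rw [← controlled_neg_one]; exact (ancDiag_smul_one _).controlled a
      · exact gen_pauli (n := 1) (S := {.inr a}) (by simp) (by simp)
          (isPauliOn_single (by simp) _)
      · obtain ⟨x, -, rfl⟩ := List.mem_map.mp hg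
        exact p.labelPair_blockDiag x
    -- The worst case is `Y`, that is `X` and `Z` with a phase. The 37 in `errorCost` is 22 for the
    -- phases at the gates plus `7 + 7 + 1`.
    have hcost : 1 + (7 + (p.wc + ℓ) * (dataCost (k + 1) * (r ^ 2 * p.wq) + 22) + 7) ≤
        errorCost k * (r ^ 2 * p.wq * (p.wc + ℓ)) := by
      have : errorCost k * (r ^ 2 * p.wq * (p.wc + ℓ)) =
        (p.wc + ℓ) * (dataCost (k + 1) * (r ^ 2 * p.wq)) +
          37 * (r ^ 2 * p.wq * (p.wc + ℓ)) := by unfold errorCost; ring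
      rw [this, mul_add]
      omega
    cases x with
    | I => rw [single_I]; exact (propagates_one _).mono (by omega)
    | X => exact hX.mono (by omega)
    | Z => exact hZ.mono (by omega)
    | Y =>
      have h := (propagates_smul_one (controlledCircuit (l.map p.labelPair)) I_mul_star).mul
        (hX.mul hZ)
      rw [smul_mul_assoc, one_mul, ← pauliOp_single_Y] at h
      exact h.mono hcost

omit hr hq [Nonempty (Fin n)] in
theorem card_qubits_le {L : ErrorLocation p.Qubit} (hL : L.Admissible p.gates) :
    L.qubits.card ≤ k + 2 := by
  rcases hL.2 with h | ⟨g, hg, h⟩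
  · omega
  · refine (Finset.card_le_card h).trans ?_
    rw [p.gates_eq] at hg
    obtain ⟨x, -, rfl⟩ := List.mem_map.mp hg
    rcases x with ⟨s, i, j⟩ | ⟨s, i⟩
    · exact Finset.card_le_two.trans (by omega)
    · refine (Finset.card_insert_le _ _).trans ?_
      rw [Finset.card_map]
      have := hk i
      omega

end StandardProtocol

end PSCProtocol

/-! ### Summation over all error locations -/

theorem corollary1 (k : ℕ) :
    ∃ C : ℕ, ∀ (n m ℓ r : ℕ) (p : StandardProtocol n m ℓ r),
      (∀ i, (p.T i).card ≤ k) → 1 ≤ r → 1 ≤ p.wq →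
      ∀ (M : ℕ) (loc : Fin M → ErrorLocation p.Qubit), (∀ i, (loc i).Admissible p.gates) →
      ∀ E : Fin M → PauliString p.Qubit, IsErrorConfiguration loc E →
        ∃ G : List (Op p.Qubit),
          (∀ U ∈ G, IsOneOrTwoQubitClifford U) ∧
          G.length ≤ C * (M * r ^ 2 * p.wq * (p.wc + ℓ)) ∧
          IsClifford G.prod ∧
          noisyOp loc E p.gates = G.prod * idealOp p.gates := by
  -- A location involves at most `k + 2` qubits, and each contributes one single-qubit error.
  refine ⟨(k + 2) * StandardProtocol.errorCost k, ?_⟩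
  intro n m ℓ r p hk hr hq M loc hloc E hE
  -- As `wq` is positive, some stabilizer has a nontrivial letter. This provides a data qubit,
  -- needed to count phases as gates, and makes `wc + ℓ` positive, needed to absorb additive
  -- constants.
  obtain ⟨j, -, hj⟩ := (Finset.lt_sup_iff (s := Finset.univ) (f := fun j : Fin n =>
    (Finset.univ.filter fun i : Fin m => p.g i j ≠ Pauli.I).card)).mp
    (show 0 < p.wq from hq)
  obtain ⟨i, hi⟩ := Finset.card_pos.mp hj
  have : Nonempty (Fin n) := ⟨j⟩
  have hw : 1 ≤ p.wc + ℓ := by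
    have h1 : (Finset.univ.filter fun j : Fin n => p.g i j ≠ Pauli.I).card ≤ p.wc :=
      Finset.le_sup (f := fun i : Fin m =>
        (Finset.univ.filter fun j : Fin n => p.g i j ≠ Pauli.I).card) (Finset.mem_univ i)
    have h2 : 0 < (Finset.univ.filter fun j : Fin n => p.g i j ≠ Pauli.I).card :=
      Finset.card_pos.mpr ⟨j, by simpa using hi⟩
    omega
  set B := StandardProtocol.errorCost k * (r ^ 2 * p.wq * (p.wc + ℓ)) with hB
  obtain ⟨F, ⟨G, h1, h2, rfl⟩, h3⟩ := exists_noisyFrom (loc := loc) (E := E) (c := (k + 2) * B)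
    p.gates 0 (fun i d => by
      rw [p.gates_eq, ← List.map_drop, p.idealOp_eq]
      refine (propagates_pauliOp (fun q x => p.propagates_single hk hr hq hw
        (List.drop_suffix d p.labels) q x) (S := (loc i).qubits) fun q hqi => ?_).mono
        (Nat.mul_le_mul_right _ (p.card_qubits_le hk (hloc i)))
      by_contra h
      exact hqi (hE i q h))
  refine ⟨G, h1, h2.trans ?_, isClifford_list_prod h1, h3⟩
  calc _ ≤ M * ((k + 2) * B) := by
        gcongr
        exact List.countP_le_length.trans (by simp)
    _ = _ := by rw [hB]; ring
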